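/- **Setting.** Let $G=(V,E)$ be a directed, possibly infinite graph in which every vertex has finitely many successors, with edge weights $\omega(u,v)\in\{1,2,3,\dots\}$; let $s\neq t$ be two vertices and $\kappa\ge 1$ an integer. A path is a finite sequence of vertices (repetitions allowed) in which consecutive vertices are joined by edges, and its cost $C(\pi)$ is the sum of the weights of its edges. Let $G_\pi$ be the set of paths from $s$ to $t$ that visit $t$ only at their end; if $t$ lies on no directed cycle, these are all the paths from $s$ to $t$. A *solution set* $\Pi$ of the $\kappa$-shortest-path problem is a set $\Pi\subseteq G_\pi$ of exactly $\min(\kappa,|G_\pi|)$ paths such that every $\pi'\in G_\pi$ with $C(\pi')<C(\pi)$ for some $\pi\in\Pi$ belongs to $\Pi$; in particular, $\Pi=G_\pi$ if $|G_\pi|\le\kappa$. In the definitions below, paths and edges leaving $t$ are disregarded. Let $g^*(v)$ be the least cost of a path from $s$ to $v$; an edge $(u,v)$ is a *sidetrack edge* if $g^*(v)<g^*(u)+\omega(u,v)$. A *centroid* is an edge together with a cost; the centroid of $\pi\in G_\pi$ consists of the first sidetrack edge of $\pi$ (of its last edge, if it has no sidetrack edge) and of the cost $C(\pi)$. The path $\pi$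 is *direct* if its centroid's edge is its last edge, and *indirect* otherwise. **The algorithm.** Let $h:V\to[0,\infty)$ satisfy $h(t)=0$ and $h(u)\le\omega(u,v)+h(v)$ for every edge $(u,v)$ (a consistent heuristic). BELA$^*$ keeps a list OPEN of nodes (a vertex $n$ with a parent $p$ and a cost $g$, where $f=g+h(n)$), a structure CLOSED (expanded vertices with their recorded costs $g(\cdot)$, and stored edges), a set $g_b(n)$ of backward costs for each vertex $n$ (initially $g_b(t)=\{0\}$, all others empty), a set $Z$ of centroids and a set $R$ of paths. Initially OPEN holds only $s$, with cost $0$ and no parent, and CLOSED, $Z$ and $R$ are empty. * While OPEN is nonempty, a node of least $f$ is popped. As long as some centroid in $Z$ costs at most this $f$, a cheapest centroid is removed from $Z$ and *processed*. Then: if the popped vertex is $t$, the edge $(p,t)$ is stored and the centroid $((p,t),g)$ is put into $Z$. Otherwise, if the popped vertex $n$ is in CLOSED, the edge $(p,n)$ is stored and, for each $b\in g_b(n)$, the centroid $((p,n),g(p)+\omega(p,n)+b)$ is put into $Z$. Otherwise $n$ is put into CLOSED with cost $g(n)=g$, the edge $(p,n)$ is stored (if $n$ has a parent), and for each successor $c$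 of $n$ a node for $c$ with parent $n$ and cost $g+\omega(n,c)$ is put into OPEN. * When OPEN is empty, cheapest centroids are removed from $Z$ and processed until $Z$ is empty; then $R$ is returned. * *Processing* $((u,v),C)$: first $\mathrm{GetPrefixes}(u,C-g(u))$ is called. A call $\mathrm{GetPrefixes}(n,b)$ does the following: if $b\notin g_b(n)$, it adds $b$ to $g_b(n)$ and puts $((p,n),g(p)+\omega(p,n)+b)$ into $Z$ for each stored edge $(p,n)$ with $g(n)<g(p)+\omega(p,n)$; then it returns $\{\langle s\rangle\}$ if $n=s$, and otherwise, for all stored edges $(p,n)$ with $g(p)+\omega(p,n)=g(n)$, the paths of $\mathrm{GetPrefixes}(p,b+\omega(p,n))$ extended by $n$. The suffixes are the paths delivered by a depth-first search along stored edges from $v$ with value $C-g(u)-\omega(u,v)$ to $t$ with value $0$, which moves from $n$ with value $b$ to $m$ if $b-\omega(n,m)\in g_b(m)$. All concatenations of a prefix and a suffix are added to $R$, and $R$ is returned at once if $|R|\ge\kappa$. Ties are broken arbitrarily. BELA$_0$ is the case $h=0$. **Theorem (Completeness and Admissibility).** For every execution of BELA$^*$ with such a heuristic $h$, and in particular of BELA$_0$: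 1. there is a solution set $\Pi$ each of whose paths is eventually added to $R$; 2. if $|G_\pi|\ge\kappa$, or if only finitely many vertices can be reached from $s$, the algorithm returns; and whenever it returns, the returned set $R$ contains a solution set $\Pi$; 3. at every moment $R\subseteq G_\pi$, and $R$ contains every path of $G_\pi$ that is strictly cheaper than some path in $R$; 4. for BELA$_0$, every path that is added to $R$ is delivered at a moment when its own centroid is processed: direct paths by a centroid whose edge ends in the goal, and indirect paths by the centroid of their first sidetrack edge. If $t$ lies on no directed cycle, all of this also holds with $G_\pi$ the set of all paths from $s$ to $t$ and with $g^*$ and the centroids defined in the whole graph $G$. -/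

import Mathlib

open scoped NNReal

namespace Bela

variable {V : Type*}

/-! ### Paths and the `κ` shortest-paths problem -/

/-- Additive cost of a path, given as the list of its vertices. -/
def pathCost (ω : V → V → ℕ) : List V → ℕ
  | u :: v :: l => ω u v + pathCost ω (v :: l)
  | _ => 0

/-- `π` is a (not necessarily simple) path of `G` from `u` to `v`. -/
def IsPath (G : Digraph V) (u v : V) (π : List V) : Prop :=
  π.IsChain G.Adj ∧ π.head? = some u ∧ π.getLast? = some v

/-- The set of all solution paths. -/
def solutionPaths (G : Digraph V) (s t : V) : Set (List V) :=
  {π | IsPath G s t π}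

/-- `P` is a solution of the `κ` shortest-paths problem from `s` to `t`: a set of `κ` distinct
solution paths (all of them, if there are no more than `κ`) that contains every solution path
cheaper than one of its members. -/
structure IsKShortest (G : Digraph V) (ω : V → V → ℕ) (s t : V) (κ : ℕ)
    (P : Set (List V)) : Prop where
  subset : P ⊆ solutionPaths G s t
  card : P.encard = min (κ : ℕ∞) (solutionPaths G s t).encard
  cheaper : ∀ π ∈ P, ∀ π' ∈ solutionPaths G s t, pathCost ω π' < pathCost ω π → π' ∈ P
  all : (solutionPaths G s t).encard ≤ κ → P = solutionPaths G s t

/-- `g*(v)`: the cost of an optimal path from `s` to `v` (used for vertices reachable from `s`). -/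
noncomputable def gStar (G : Digraph V) (ω : V → V → ℕ) (s v : V) : ℕ :=
  sInf {c | ∃ π, IsPath G s v π ∧ pathCost ω π = c}

def IsTreeEdge (G : Digraph V) (ω : V → V → ℕ) (s u v : V) : Prop :=
  G.Adj u v ∧ gStar G ω s v = gStar G ω s u + ω u v

def IsSidetrack (G : Digraph V) (ω : V → V → ℕ) (s u v : V) : Prop :=
  G.Adj u v ∧ gStar G ω s v < gStar G ω s u + ω u v

/-- A centroid: an edge `(src, dst)` together with an overall cost. -/
@[ext]
structure Centroid (V : Type*) where
  src : V
  dst : V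
  cost : ℕ

/-- `z` is the centroid of the solution path `π`: its cost is that of `π`, and its edge is the first
sidetrack edge of `π` or, if `π` has no sidetrack edge, the last edge of `π`.
(`φ` is the part of `π` that precedes the edge, `τ` the part that follows it. The path is direct
exactly when `τ` is just the goal.) -/
def IsCentroidOf (G : Digraph V) (ω : V → V → ℕ) (s : V) (z : Centroid V) (π : List V) : Prop :=
  z.cost = pathCost ω π ∧
  ∃ φ τ : List V, π = φ ++ τ ∧ φ.getLast? = some z.src ∧ τ.head? = some z.dst ∧
    φ.IsChain (IsTreeEdge G ω s) ∧
    (IsSidetrack G ω s z.src z.dst ∨ (IsTreeEdge G ω s z.src z.dst ∧ τ = [z.dst]))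

/-- `h` is a consistent heuristic with `h t = 0` (and hence admissible). -/
def IsConsistent (G : Digraph V) (ω : V → V → ℕ) (t : V) (h : V → ℝ≥0) : Prop :=
  h t = 0 ∧ ∀ u v, G.Adj u v → h u ≤ ω u v + h v

/-! ### The algorithm -/

/-- An entry of OPEN: a vertex, the parent that generated it (none for the start vertex), and the
cost of the path by which it was generated. -/
@[ext]
structure Node (V : Type*) where
  vertex : V
  parent : Option V
  g : ℕ

/-- The `f`-value of a node. -/
noncomputable def Node.f (h : V → ℝ≥0) (n : Node V) : ℝ≥0 := n.g + h n.vertex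

/-- Where the execution stands: at the test of the outer loop (OPEN is nonempty), in the body of the
outer loop with the node just popped, in the final loop over the centroids, or after the return. -/
inductive Control (V : Type*) where
  | outer
  | inner (n : Node V)
  | final
  | halted

/-- The memory of the algorithm. CLOSED consists of the expanded vertices, their `g`-values, and the
edges stored so far. Every vertex is expanded at most once, so that no entry of OPEN is ever
generated twice and OPEN can be kept as a set. -/
structure State (V : Type*) where
  /-- the nodes in OPEN -/
  opn : Set (Node V)
  /-- the vertices in CLOSED -/
  expanded : Set V
  /-- the `g`-value recorded at expansion (meaningful on `expanded`) -/
  g : V → ℕ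
  /-- the edges in CLOSED -/
  edges : Set (V × V)
  /-- the known `g_b`-values of every vertex -/
  gb : V → Set ℕ
  /-- the pending centroids -/
  Z : Set (Centroid V)
  /-- the solution paths found so far -/
  found : Set (List V)
  control : Control V

/-- Initially OPEN holds the start vertex with cost `0`, and the only known `g_b`-value is the
value `0` of the goal. -/
def initial (s t : V) : State V where
  opn := {⟨s, none, 0⟩}
  expanded := ∅
  g := fun _ => 0
  edges := ∅
  gb := fun v => {b | v = t ∧ b = 0}
  Z := ∅
  found := ∅
  control := .outer

/-- `PrefixCall ω s σ u b n c`: evaluating `GetPrefixes(u, b)` leads to the (recursive) call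
`GetPrefixes(n, c)`. -/
inductive PrefixCall (ω : V → V → ℕ) (s : V) (σ : State V) (u : V) (b : ℕ) : V → ℕ → Prop
  | base : PrefixCall ω s σ u b u b
  | step {n p : V} {c : ℕ} : PrefixCall ω s σ u b n c → n ≠ s → (p, n) ∈ σ.edges →
      σ.g p + ω p n = σ.g n → PrefixCall ω s σ u b p (c + ω p n)

/-- The paths returned by `GetPrefixes(n, _)`. -/
inductive IsPrefix (ω : V → V → ℕ) (s : V) (σ : State V) : V → List V → Prop
  | start : IsPrefix ω s σ s [s]
  | snoc {n p : V} {l : List V} : n ≠ s → (p, n) ∈ σ.edges → σ.g p + ω p n = σ.g n →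
      IsPrefix ω s σ p l → IsPrefix ω s σ n (l ++ [n])

/-- The effect of `GetPrefixes(u, b)` on the memory: every call `GetPrefixes(n, c)` with a new
value `c` records this value at `n` and creates one centroid for each sidetrack edge stored
in CLOSED that ends in `n`. -/
def getPrefixes (ω : V → V → ℕ) (s : V) (σ : State V) (u : V) (b : ℕ) : State V :=
  { σ with
    gb := fun n => σ.gb n ∪ {c | PrefixCall ω s σ u b n c}
    Z := σ.Z ∪ {z | ∃ p n c, PrefixCall ω s σ u b n c ∧ c ∉ σ.gb n ∧ (p, n) ∈ σ.edges ∧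
      σ.g n < σ.g p + ω p n ∧ z = ⟨p, n, σ.g p + ω p n + c⟩} }

/-- Suffix construction: `IsSuffix ω t σ n c τ` says that the depth-first search in CLOSED from `n`
with `g_b`-value `c` delivers `τ`. The next node is a child whose `g_b`-values include `c` minus the
cost of the edge, until the goal is reached. -/
inductive IsSuffix (ω : V → V → ℕ) (t : V) (σ : State V) : V → ℕ → List V → Prop
  | goal : IsSuffix ω t σ t 0 [t]
  | cons {n m : V} {c : ℕ} {l : List V} : n ≠ t → (n, m) ∈ σ.edges → c ∈ σ.gb m →
      IsSuffix ω t σ m c l → IsSuffix ω t σ n (c + ω n m) (n :: l)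

/-- The memory after the prefix construction for the centroid `z`, which has just been removed
from the set of centroids. -/
def afterPrefixes (ω : V → V → ℕ) (s : V) (σ : State V) (z : Centroid V) : State V :=
  getPrefixes ω s { σ with Z := σ.Z \ {z} } z.src (z.cost - σ.g z.src)

/-- `GetPaths(z)`: the cross-product of all prefixes and all suffixes of `z`. -/
def getPaths (ω : V → V → ℕ) (s t : V) (σ : State V) (z : Centroid V) : Set (List V) :=
  {π | ∃ (φ τ : List V) (c : ℕ), IsPrefix ω s σ z.src φ ∧
    IsSuffix ω t (afterPrefixes ω s σ z) z.dst c τ ∧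
    z.cost = σ.g z.src + ω z.src z.dst + c ∧ π = φ ++ τ}

open Classical in
/-- Pop the centroid `z`, add its paths, and return if `κ` paths have been found. -/
noncomputable def consume (ω : V → V → ℕ) (s t : V) (κ : ℕ) (σ : State V) (z : Centroid V) :
    State V :=
  { afterPrefixes ω s σ z with
    found := σ.found ∪ getPaths ω s t σ z
    control :=
      if (κ : ℕ∞) ≤ (σ.found ∪ getPaths ω s t σ z).encard then .halted else σ.control }

/-- In state `σ` the algorithm may pop the centroid `z`: it is one of the cheapest pending centroids,
and the execution is in the final loop, or else in the outer loop with a popped node whose `f`-value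
is at least the cost of `z`. -/
def MayConsume (h : V → ℝ≥0) (σ : State V) (z : Centroid V) : Prop :=
  z ∈ σ.Z ∧ (∀ z' ∈ σ.Z, z.cost ≤ z'.cost) ∧
    (σ.control = .final ∨ ∃ n, σ.control = .inner n ∧ (z.cost : ℝ≥0) ≤ n.f h)

/-- A copy of the goal has been popped: its edge is stored and the corresponding centroid is created;
the goal is not expanded. -/
def reachGoal (t : V) (σ : State V) (n : Node V) : State V :=
  { σ with
    edges := σ.edges ∪ {e | ∃ p, n.parent = some p ∧ e = (p, t)}
    Z := σ.Z ∪ {z | ∃ p, n.parent = some p ∧ z = ⟨p, t, n.g⟩}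
    control := .outer }

/-- A copy of a vertex in CLOSED has been popped: its edge is stored and one centroid is created for
every known `g_b`-value of the vertex. -/
def duplicate (ω : V → V → ℕ) (σ : State V) (n : Node V) : State V :=
  { σ with
    edges := σ.edges ∪ {e | ∃ p, n.parent = some p ∧ e = (p, n.vertex)}
    Z := σ.Z ∪ {z | ∃ p c, n.parent = some p ∧ c ∈ σ.gb n.vertex ∧
      z = ⟨p, n.vertex, σ.g p + ω p n.vertex + c⟩}
    control := .outer }

open Classical in
/-- A new vertex has been popped: it is added to CLOSED (with its edge), and its children are
generated. -/
noncomputable def expand (G : Digraph V) (ω : V → V → ℕ) (σ : State V) (n : Node V) : State V :=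
  { σ with
    opn := σ.opn ∪ {m | ∃ c, G.Adj n.vertex c ∧ m = ⟨c, some n.vertex, n.g + ω n.vertex c⟩}
    expanded := insert n.vertex σ.expanded
    g := Function.update σ.g n.vertex n.g
    edges := σ.edges ∪ {e | ∃ p, n.parent = some p ∧ e = (p, n.vertex)}
    control := .outer }

/-- One step of the algorithm BELA* with heuristic `h` on input `G, ω, s, t, κ`. Ties between nodes
with equal `f`-values and between centroids of equal cost are broken arbitrarily.
With `h = 0` this is BELA₀. -/
inductive Step (G : Digraph V) (ω : V → V → ℕ) (s t : V) (κ : ℕ) (h : V → ℝ≥0) :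
    State V → State V → Prop
  | pop {σ : State V} {n : Node V} : σ.control = .outer → n ∈ σ.opn →
      (∀ m ∈ σ.opn, n.f h ≤ m.f h) →
      Step G ω s t κ h σ { σ with opn := σ.opn \ {n}, control := .inner n }
  | exhausted {σ : State V} : σ.control = .outer → σ.opn = ∅ →
      Step G ω s t κ h σ { σ with control := .final }
  | consume {σ : State V} {z : Centroid V} : MayConsume h σ z →
      Step G ω s t κ h σ (consume ω s t κ σ z)
  | goal {σ : State V} {n : Node V} : σ.control = .inner n →
      (∀ z ∈ σ.Z, n.f h < z.cost) → n.vertex = t →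
      Step G ω s t κ h σ (reachGoal t σ n)
  | duplicate {σ : State V} {n : Node V} : σ.control = .inner n →
      (∀ z ∈ σ.Z, n.f h < z.cost) → n.vertex ≠ t → n.vertex ∈ σ.expanded →
      Step G ω s t κ h σ (duplicate ω σ n)
  | expand {σ : State V} {n : Node V} : σ.control = .inner n →
      (∀ z ∈ σ.Z, n.f h < z.cost) → n.vertex ≠ t → n.vertex ∉ σ.expanded →
      Step G ω s t κ h σ (expand G ω σ n)
  | finish {σ : State V} : σ.control = .final → σ.Z = ∅ →
      Step G ω s t κ h σ { σ with control := .halted }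

/-- A maximal execution of the algorithm: the sequence of states, in which the last state is repeated
forever if no further step is possible. -/
def IsRun (G : Digraph V) (ω : V → V → ℕ) (s t : V) (κ : ℕ) (h : V → ℝ≥0)
    (ρ : ℕ → State V) : Prop :=
  ρ 0 = initial s t ∧
  ∀ i, Step G ω s t κ h (ρ i) (ρ (i + 1)) ∨
    ((∀ σ, ¬ Step G ω s t κ h (ρ i) σ) ∧ ρ (i + 1) = ρ i)

/-! ### Completeness and admissibility -/

/-- The execution `ρ` is complete and admissible for the `κ` shortest-paths problem on `G`. -/
structure IsCompleteAdmissible (G : Digraph V) (ω : V → V → ℕ) (s t : V) (κ : ℕ)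
    (ρ : ℕ → State V) : Prop where
  /-- Every path of some solution set is eventually found. -/
  complete : ∃ P, IsKShortest G ω s t κ P ∧ ∀ π ∈ P, ∃ i, π ∈ (ρ i).found
  /-- The execution returns if there are at least `κ` solution paths, or if only finitely many
  vertices can be reached from `s`. -/
  returns : (κ : ℕ∞) ≤ (solutionPaths G s t).encard ∨ {v | Relation.ReflTransGen G.Adj s v}.Finite →
    ∃ i, (ρ i).control = .halted
  /-- Whatever is returned contains a solution set. -/
  returned : ∀ i, (ρ i).control = .halted → ∃ P ⊆ (ρ i).found, IsKShortest G ω s t κ P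
  /-- Only solution paths are found, -/
  sound : ∀ i, (ρ i).found ⊆ solutionPaths G s t
  /-- and no path is found before all strictly cheaper solution paths. -/
  admissible : ∀ i, ∀ π ∈ (ρ i).found, ∀ π' ∈ solutionPaths G s t,
    pathCost ω π' < pathCost ω π → π' ∈ (ρ i).found

/-- Every solution path found in the execution `ρ` is delivered by `GetPaths` from the centroid of
that path. -/
def RecoversFromCentroids (G : Digraph V) (ω : V → V → ℕ) (s t : V) (κ : ℕ) (h : V → ℝ≥0)
    (ρ : ℕ → State V) : Prop :=
  ∀ j, ∀ π ∈ (ρ j).found, ∃ i < j, ∃ z, MayConsume h (ρ i) z ∧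
    ρ (i + 1) = consume ω s t κ (ρ i) z ∧ π ∈ getPaths ω s t (ρ i) z ∧ IsCentroidOf G ω s z π

/-- The graph `G` without the edges that leave `t`. The paths from `s` to `t` in this graph are the
paths of `G` from `s` that visit `t` only at their end. -/
def stopAt (G : Digraph V) (t : V) : Digraph V where
  Adj u v := G.Adj u v ∧ u ≠ t

end Bela

/-!
BELA* is a best-first search whose node for an edge `(p, v)` is pending from the expansion of `p` until
the edge is stored. Consistency of the heuristic makes the popped `f`-values nondecreasing, so that a
stored edge never offers a shorter way to an expanded vertex. Hence every path from `s` is either stored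
completely, at a cost no smaller than the recorded `g`-value of its end, or the continuation of its
stored part is a pending node whose `f`-value is at most the cost of the path plus the heuristic value of
its end (`SearchInv.stored_or_pending`). In particular the recorded `g`-values are optimal.

Backward costs travel against the stored edges. If `c` is known at `v` and the edge `(p, v)` is stored,
then `c + ω p v` is known at `p`, or the centroid of cost `g p + ω p v + c` that will carry it there is
pending. Moreover `g v + c` is a lower bound for the values of all pending nodes and centroids, since
centroids are processed in order of their costs and every new one costs at least as much as those
before. Now take a completely stored solution path without pending centroids. All costs of its final
parts are known at their vertices, so the depth-first search delivers each of its final parts. When the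
last pending centroid on the path is processed, the part of the path before that centroid's edge
consists of tree edges, because a sidetrack edge there would get a new, dearer centroid. So the path is
then delivered (`CentroidInv.complete_collect`).

Therefore a solution path that has not been found is announced by a pending node or centroid of no
greater value (`CentroidInv.exists_pending_or_centroid`). This gives admissibility at once. It also
gives progress: until the path is found, only work of bounded cost is done. As the weights are positive
integers and the branching is finite, only finitely many edges and backward costs are involved, and
all steps but those that pop a node or find OPEN empty increase the number of those dealt with
(`progress`, `RunInv.progress_lt`). If finitely many vertices are
reachable and there are fewer than `κ` solution paths, all costs are bounded, because the cost of each
centroid is the cost of a solution path, and the same measure gives termination.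

With the zero heuristic, a known backward cost `c > 0` at `v` satisfies `g v + c ≤ g p + ω p v` when a
copy of `v` with parent `p` is popped. Every pending centroid that does not end in the goal is thus that
of a sidetrack edge, which is the first one on the delivered paths (`RunInv.isCentroidOf`).
Finally, if `t` lies on no directed cycle, the paths that can be continued to `t` are the same with and
without the edges leaving `t` (`isPath_stopAt_iff`).
-/

namespace Bela

variable {V : Type*}

/-! ### Paths and their costs -/

section Paths

variable {G : Digraph V} {ω : V → V → ℕ} {s t u v w : V} {π φ τ : List V}

theorem pathCost_append (hu : φ.getLast? = some u) (hv : τ.head? = some v) :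
    pathCost ω (φ ++ τ) = pathCost ω φ + ω u v + pathCost ω τ := by
  induction φ with
  | nil => simp at hu
  | cons a φ ih =>
    cases φ with
    | nil =>
      cases τ with
      | nil => simp at hv
      | cons b τ => simp_all [pathCost]
    | cons b φ =>
      have := ih (by simpa [List.getLast?_cons_cons] using hu)
      simp only [List.cons_append, pathCost] at this ⊢
      omega

theorem pathCost_append_cons (α β : List V) (u : V) :
    pathCost ω (α ++ u :: β) = pathCost ω (α ++ [u]) + pathCost ω (u :: β) := by
  cases β with
  | nil => simp [pathCost]
  | cons v β =>
    have h := pathCost_append (ω := ω) (φ := α ++ [u]) (τ := v :: β) (u := u) (v := v)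
      (by simp) (by simp)
    simp only [List.append_assoc, List.singleton_append] at h
    rw [h, pathCost, add_assoc]

theorem IsPath.refl (G : Digraph V) (v : V) : IsPath G v v [v] := by
  simp [IsPath]

theorem IsPath.append (hφ : IsPath G s u φ) (huv : G.Adj u v) (hτ : IsPath G v t τ) :
    IsPath G s t (φ ++ τ) := by
  obtain ⟨h1, h2, h3⟩ := hφ
  obtain ⟨k1, k2, k3⟩ := hτ
  refine ⟨List.IsChain.append h1 k1 ?_, by simp [h2], by simp [k3]⟩
  intro x hx y hy
  simp_all

theorem IsPath.cost_append (hφ : IsPath G s u φ) (hτ : IsPath G v t τ) :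
    pathCost ω (φ ++ τ) = pathCost ω φ + ω u v + pathCost ω τ :=
  pathCost_append hφ.2.2 hτ.2.1

theorem IsPath.snoc (hφ : IsPath G s u φ) (huv : G.Adj u v) : IsPath G s v (φ ++ [v]) :=
  hφ.append huv (.refl G v)

theorem IsPath.cost_snoc (hφ : IsPath G s u φ) :
    pathCost ω (φ ++ [v]) = pathCost ω φ + ω u v := by
  rw [hφ.cost_append (.refl G v)]; rfl

/-- The part of a path from one of its vertices onwards. -/
theorem IsPath.suffix {α β : List V} (h : IsPath G s t (α ++ u :: β)) : IsPath G u t (u :: β) :=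
  ⟨h.1.right_of_append, rfl, by simpa using h.2.2⟩

/-- The part of a path up to one of its vertices. -/
theorem IsPath.prefix {α β : List V} (h : IsPath G s t (α ++ u :: β)) :
    IsPath G s u (α ++ [u]) := by
  refine ⟨List.IsChain.prefix h.1 ⟨β, by simp⟩, ?_, by simp⟩
  have := h.2.1
  cases α <;> simpa using this

theorem IsPath.adj {α β : List V} (h : IsPath G s t (α ++ u :: v :: β)) : G.Adj u v :=
  (List.isChain_cons_cons.1 h.1.right_of_append).1

/-- Induction on a path from its start. -/
theorem IsPath.snoc_induction {motive : V → List V → Prop} (start : motive s [s])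
    (snoc : ∀ u v π, IsPath G s u π → G.Adj u v → motive u π → motive v (π ++ [v]))
    (h : IsPath G s v π) : motive v π := by
  induction π using List.reverseRecOn generalizing v with
  | nil => simp [IsPath] at h
  | append_singleton π x ih =>
    obtain rfl : x = v := by simpa using h.2.2
    rcases List.eq_nil_or_concat' π with rfl | ⟨π', u, rfl⟩
    · obtain rfl : x = s := by simpa using h.2.1
      exact start
    · have h' : IsPath G s x (π' ++ u :: [x]) := by simpa using h
      exact snoc u x _ h'.prefix h'.adj (ih h'.prefix)

/-- Induction on a path from its end. -/
theorem IsPath.cons_induction {motive : V → List V → Prop} (last : motive t [t])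
    (cons : ∀ u v l, G.Adj u v → IsPath G v t (v :: l) → motive v (v :: l) →
      motive u (u :: v :: l))
    (h : IsPath G u t π) : motive u π := by
  induction π generalizing u with
  | nil => simp [IsPath] at h
  | cons x π ih =>
    obtain rfl : x = u := by simpa using h.2.1
    cases π with
    | nil =>
      obtain rfl : x = t := by simpa using h.2.2
      exact last
    | cons v l =>
      have h' : IsPath G v t (v :: l) := IsPath.suffix (α := [x]) h
      exact cons x v l (IsPath.adj (α := []) h) h' (ih h')

/-- With positive integer weights, only finitely many vertices can be reached at bounded cost. -/
theorem finite_reachable_of_cost_le (hω : ∀ u v, G.Adj u v → 0 < ω u v)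
    (hfin : ∀ u, {v | G.Adj u v}.Finite) (s : V) (C : ℕ) :
    {v | ∃ π, IsPath G s v π ∧ pathCost ω π ≤ C}.Finite := by
  induction C with
  | zero =>
    refine (Set.finite_singleton s).subset ?_
    rintro v ⟨π, hπ, hC⟩
    revert hC
    refine IsPath.snoc_induction (motive := fun v π => pathCost ω π ≤ 0 → v ∈ ({s} : Set V)) ?_ ?_ hπ
    · simp
    · intro u v π hπ huv _ hC
      have := hω _ _ huv
      rw [hπ.cost_snoc] at hC
      omega
  | succ C ih =>
    refine ((Set.finite_singleton s).union (ih.biUnion fun u _ => hfin u)).subset ?_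
    rintro v ⟨π, hπ, hC⟩
    revert hC
    refine IsPath.snoc_induction (motive := fun v π => pathCost ω π ≤ C + 1 → v ∈ _) ?_ ?_ hπ
    · simp
    · intro u v π hπ huv _ hC
      have := hω _ _ huv
      rw [hπ.cost_snoc] at hC
      exact Or.inr (Set.mem_biUnion (x := u) ⟨π, hπ, by omega⟩ huv)

theorem IsPath.reflTransGen (h : IsPath G u v π) : Relation.ReflTransGen G.Adj u v :=
  IsPath.snoc_induction (motive := fun v _ => Relation.ReflTransGen G.Adj u v) .refl
    (fun _ _ _ _ h ih => ih.tail h) h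

theorem gStar_le (h : IsPath G s v π) : gStar G ω s v ≤ pathCost ω π :=
  Nat.sInf_le ⟨π, h, rfl⟩

theorem heuristic_le_of_isPath {h : V → ℝ≥0} (hcons : ∀ u v, G.Adj u v → h u ≤ ω u v + h v)
    (hπ : IsPath G u t π) : h u ≤ pathCost ω π + h t := by
  refine IsPath.cons_induction (motive := fun u π => h u ≤ pathCost ω π + h t) ?_ ?_ hπ
  · simp [pathCost]
  · intro u v l huv _ ih
    have := hcons u v huv
    simp only [pathCost, Nat.cast_add] at ih ⊢
    linarith

end Paths

/-! ### Selecting cheapest elements -/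

/-- Among the elements of a set `S` one can select any number of cheapest ones. -/
theorem exists_cheapest {α : Type*} (f : α → ℕ) (S : Set α) (κ : ℕ) (hκ : (κ : ℕ∞) ≤ S.encard) :
    ∃ P ⊆ S, P.encard = κ ∧ ∀ x ∈ P, ∀ y ∈ S, f y < f x → y ∈ P := by
  induction κ with
  | zero => exact ⟨∅, by simp, by simp, by simp⟩
  | succ κ ih =>
    obtain ⟨P, hPS, hcard, hP⟩ := ih (le_trans (by norm_cast; omega) hκ)
    have hne : (S \ P).Nonempty := by
      rw [Set.sdiff_nonempty]
      intro hSP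
      have h1 := Set.encard_le_encard hSP
      rw [hcard] at h1
      have := hκ.trans h1
      norm_cast at this
      omega
    obtain ⟨x, hx, hmin⟩ : ∃ x ∈ S \ P, ∀ y ∈ S \ P, f x ≤ f y := by
      have := (InvImage.wf f Nat.lt_wfRel.wf).has_min _ hne
      obtain ⟨x, hx, hmin⟩ := this
      exact ⟨x, hx, fun y hy => not_lt.1 (hmin y hy)⟩
    refine ⟨insert x P, Set.insert_subset hx.1 hPS, ?_, ?_⟩
    · rw [Set.encard_insert_of_notMem hx.2, hcard]; push_cast; rfl
    · rintro y (rfl | hy) z hz hlt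
      · by_contra hzP
        exact absurd (hmin z ⟨hz, fun h => hzP (.inr h)⟩) (not_le.2 hlt)
      · exact .inr (hP y hy z hz hlt)

/-- A set of `κ` or more solution paths that contains every path cheaper than one of its members
contains a solution of the `κ` shortest-paths problem. -/
theorem exists_isKShortest_subset {G : Digraph V} {ω : V → V → ℕ} {s t : V} {κ : ℕ}
    {S : Set (List V)} (hS : S ⊆ solutionPaths G s t)
    (hcheap : ∀ π ∈ S, ∀ π' ∈ solutionPaths G s t, pathCost ω π' < pathCost ω π → π' ∈ S)
    (hκ : (κ : ℕ∞) ≤ S.encard ∨ solutionPaths G s t ⊆ S) :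
    ∃ P ⊆ S, IsKShortest G ω s t κ P := by
  by_cases hle : (solutionPaths G s t).encard ≤ κ
  · have hsub : solutionPaths G s t ⊆ S := by
      rcases hκ with hκ | hκ
      · have hf : (solutionPaths G s t).Finite := Set.finite_of_encard_le_coe hle
        exact ((hf.subset hS).eq_of_subset_of_encard_le hS (hle.trans hκ)).ge
      · exact hκ
    exact ⟨_, hsub, subset_rfl, (min_eq_right hle).symm, fun _ _ _ h _ => h, fun _ => rfl⟩
  · have hκ' : (κ : ℕ∞) ≤ S.encard := by
      rcases hκ with hκ | hκ
      · exact hκ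
      · exact (not_le.1 hle).le.trans (Set.encard_le_encard hκ)
    obtain ⟨P, hPS, hcard, hP⟩ := exists_cheapest (pathCost ω) S κ hκ'
    refine ⟨P, hPS, hPS.trans hS, ?_, ?_, fun h => absurd h hle⟩
    · rw [hcard, min_eq_left (not_le.1 hle).le]
    · intro π hπ π' hπ' hlt
      exact hP π hπ π' (hcheap π (hPS hπ) π' hπ' hlt) hlt

/-! ### The search in the graph -/

/-- The node `x` has been generated but not yet dealt with: it is in OPEN, or it is the node that has
just been popped. -/
def Pending (σ : State V) (x : Node V) : Prop :=
  x ∈ σ.opn ∨ σ.control = .inner x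

/-- The invariant of the best-first search, which concerns OPEN, the expanded vertices with their
`g`-values, and the stored edges. It says that the edges leaving expanded vertices are split into
stored and pending ones, that stored edges never offer a shorter way to an expanded vertex, and that
the `f`-values of expanded vertices bound those of pending nodes from below. -/
structure SearchInv (G : Digraph V) (ω : V → V → ℕ) (s t : V) (h : V → ℝ≥0) (σ : State V) :
    Prop where
  open_finite : σ.opn.Finite
  start : s ∈ σ.expanded ∨ (σ.expanded = ∅ ∧ Pending σ ⟨s, none, 0⟩)
  pending_start : ∀ x, Pending σ x → x.parent = none → s ∉ σ.expanded ∧ x = ⟨s, none, 0⟩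
  pending_edge : ∀ x p, Pending σ x → x.parent = some p → p ∈ σ.expanded ∧
    (stopAt G t).Adj p x.vertex ∧ x.g = σ.g p + ω p x.vertex ∧ (p, x.vertex) ∉ σ.edges
  frontier : ∀ p v, p ∈ σ.expanded → (stopAt G t).Adj p v →
    (p, v) ∈ σ.edges ∨ Pending σ ⟨v, some p, σ.g p + ω p v⟩
  edge : ∀ p v, (p, v) ∈ σ.edges → p ∈ σ.expanded ∧ (stopAt G t).Adj p v ∧
    (v ≠ t → v ∈ σ.expanded ∧ σ.g v ≤ σ.g p + ω p v)
  goal_not_expanded : t ∉ σ.expanded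
  g_start : σ.g s = 0
  path : ∀ v ∈ σ.expanded, ∃ π, IsPath (stopAt G t) s v π ∧ pathCost ω π = σ.g v
  f_le : ∀ v ∈ σ.expanded, ∀ x, Pending σ x → σ.g v + h v ≤ x.f h
  inner_le : ∀ x, σ.control = .inner x → x ∉ σ.opn ∧ ∀ y ∈ σ.opn, x.f h ≤ y.f h
  final : σ.control = .final → σ.opn = ∅

section Search

variable {G : Digraph V} {ω : V → V → ℕ} {s t : V} {h : V → ℝ≥0} {σ σ' : State V} {x : Node V}

theorem SearchInv.initial : SearchInv G ω s t h (initial s t) where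
  open_finite := Set.finite_singleton _
  start := .inr ⟨rfl, .inl rfl⟩
  pending_start := by
    rintro x (hx | hx) _
    · exact ⟨fun h => h, hx⟩
    · cases hx
  pending_edge := by
    rintro x p (hx | hx) hp
    · obtain rfl : x = ⟨s, none, 0⟩ := hx
      cases hp
    · cases hx
  frontier := fun _ _ h => h.elim
  edge := fun _ _ h => h.elim
  goal_not_expanded := fun h => h
  g_start := rfl
  path := fun _ h => h.elim
  f_le := fun _ h => h.elim
  inner_le := by intro x hx; cases hx
  final := by intro hx; cases hx

/-- The invariant does not mention the centroids. -/
theorem SearchInv.congr (H : SearchInv G ω s t h σ) (hopn : σ'.opn = σ.opn)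
    (hexp : σ'.expanded = σ.expanded) (hg : σ'.g = σ.g) (hedges : σ'.edges = σ.edges)
    (hcontrol : σ'.control = σ.control) : SearchInv G ω s t h σ' := by
  obtain ⟨opn, expanded, g, edges, gb, Z, found, control⟩ := σ'
  dsimp only at hopn hexp hg hedges hcontrol
  subst hopn hexp hg hedges hcontrol
  exact ⟨H.open_finite, H.start, H.pending_start, H.pending_edge, H.frontier, H.edge,
    H.goal_not_expanded, H.g_start, H.path, H.f_le, H.inner_le, H.final⟩

/-- Moving a node from OPEN into the body of the loop does not change the set of pending nodes. -/
theorem pending_pop (hc : σ.control = .outer) (hx : x ∈ σ.opn) (y : Node V) :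
    Pending { σ with opn := σ.opn \ {x}, control := .inner x } y ↔ Pending σ y := by
  by_cases hyx : y = x
  · subst hyx; simp [Pending, hx]
  · simp [Pending, hc, hyx, Ne.symm hyx]

theorem SearchInv.pop (H : SearchInv G ω s t h σ) (hc : σ.control = .outer) (hx : x ∈ σ.opn)
    (hmin : ∀ m ∈ σ.opn, x.f h ≤ m.f h) :
    SearchInv G ω s t h { σ with opn := σ.opn \ {x}, control := .inner x } where
  open_finite := H.open_finite.sdiff
  start := by simpa only [pending_pop hc hx] using H.start
  pending_start := by simpa only [pending_pop hc hx] using H.pending_start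
  pending_edge := by simpa only [pending_pop hc hx] using H.pending_edge
  frontier := by simpa only [pending_pop hc hx] using H.frontier
  edge := H.edge
  goal_not_expanded := H.goal_not_expanded
  g_start := H.g_start
  path := H.path
  f_le := by simpa only [pending_pop hc hx] using H.f_le
  inner_le := by
    intro y hy
    obtain rfl : x = y := by simpa using hy
    exact ⟨by simp, fun m hm => hmin m hm.1⟩
  final := by intro hx; cases hx

theorem pending_exhausted (hc : σ.control = .outer) (y : Node V) :
    Pending { σ with control := .final } y ↔ Pending σ y := by
  simp [Pending, hc]

theorem SearchInv.exhausted (H : SearchInv G ω s t h σ) (hc : σ.control = .outer)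
    (hopn : σ.opn = ∅) : SearchInv G ω s t h { σ with control := .final } where
  open_finite := H.open_finite
  start := by simpa only [pending_exhausted hc] using H.start
  pending_start := by simpa only [pending_exhausted hc] using H.pending_start
  pending_edge := by simpa only [pending_exhausted hc] using H.pending_edge
  frontier := by simpa only [pending_exhausted hc] using H.frontier
  edge := H.edge
  goal_not_expanded := H.goal_not_expanded
  g_start := H.g_start
  path := H.path
  f_le := by simpa only [pending_exhausted hc] using H.f_le
  inner_le := by intro y hy; cases hy
  final := fun _ => hopn

/-- Before the start vertex is expanded, it is the only pending node. -/
theorem SearchInv.eq_start (H : SearchInv G ω s t h σ) (hs : s ∉ σ.expanded)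
    (hx : Pending σ x) : x = ⟨s, none, 0⟩ := by
  obtain hs' | ⟨he, -⟩ := H.start
  · exact absurd hs' hs
  · cases hp : x.parent with
    | none => exact (H.pending_start x hx hp).2
    | some p =>
      have := (H.pending_edge x p hx hp).1
      simp [he] at this

/-- There is only one pending node for each edge. -/
theorem SearchInv.pending_unique (H : SearchInv G ω s t h σ) {y : Node V} {p : V}
    (hx : Pending σ x) (hy : Pending σ y) (hxp : x.parent = some p) (hyp : y.parent = some p)
    (hv : x.vertex = y.vertex) : x = y := by
  have h1 := (H.pending_edge x p hx hxp).2.2.1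
  have h2 := (H.pending_edge y p hy hyp).2.2.1
  exact Node.ext hv (hxp.trans hyp.symm) (by rw [h1, h2, hv])

/-- A popped copy of the goal or of an expanded vertex has a parent. -/
theorem SearchInv.exists_parent (H : SearchInv G ω s t h σ) (hst : s ≠ t)
    (hx : Pending σ x) (hv : x.vertex = t ∨ x.vertex ∈ σ.expanded) :
    ∃ p, x.parent = some p := by
  cases hp : x.parent with
  | some p => exact ⟨p, rfl⟩
  | none =>
    obtain ⟨hs, rfl⟩ := H.pending_start x hx hp
    rcases hv with hv | hv
    · exact absurd hv hst
    · exact absurd hv hs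

theorem pending_of_duplicate {y : Node V} (hy : Pending (duplicate ω σ x) y) : y ∈ σ.opn := by
  simpa [Pending, duplicate] using hy

theorem SearchInv.duplicate (H : SearchInv G ω s t h σ) (hst : s ≠ t) (hc : σ.control = .inner x)
    (hv : x.vertex = t ∨ x.vertex ∈ σ.expanded) : SearchInv G ω s t h (duplicate ω σ x) := by
  have hx : Pending σ x := .inr hc
  obtain ⟨hxo, -⟩ := H.inner_le x hc
  obtain ⟨p, hp⟩ := H.exists_parent hst hx hv
  obtain ⟨hpe, hadj, hg, -⟩ := H.pending_edge x p hx hp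
  have hs : s ∈ σ.expanded := by
    by_contra hs
    have := H.eq_start hs hx
    simp [this] at hp
  refine ⟨H.open_finite, .inl hs, ?_, ?_, ?_, ?_, H.goal_not_expanded, H.g_start, H.path, ?_,
    ?_, ?_⟩
  · intro y hy hyp
    exact H.pending_start y (.inl (pending_of_duplicate hy)) hyp
  · intro y q hy hq
    replace hy := pending_of_duplicate hy
    obtain ⟨k1, k2, k3, k4⟩ := H.pending_edge y q (.inl hy) hq
    refine ⟨k1, k2, k3, ?_⟩
    rintro (k | ⟨q', hq', k⟩)
    · exact k4 k
    · obtain ⟨rfl, hk⟩ := Prod.mk.inj k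
      have := H.pending_unique hx (.inl hy) hq' hq hk.symm
      exact hxo (this ▸ hy)
  · intro q v hq hqv
    rcases H.frontier q v hq hqv with k | k | k
    · exact .inl (.inl k)
    · exact .inr (.inl k)
    · rw [hc] at k
      obtain rfl := Control.inner.inj k
      exact .inl (.inr ⟨q, rfl, rfl⟩)
  · rintro q v (k | ⟨q', hq', k⟩)
    · exact H.edge q v k
    · obtain ⟨rfl, rfl⟩ := Prod.mk.inj k
      obtain rfl : p = q := by simpa [hp] using hq'
      refine ⟨hpe, hadj, fun hvt => ?_⟩
      have hve : x.vertex ∈ σ.expanded := by simpa [hvt] using hv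
      refine ⟨hve, ?_⟩
      have := H.f_le _ hve x hx
      rw [Node.f, hg] at this
      have := le_of_add_le_add_right this
      exact_mod_cast this
  · exact fun v hv' y hy => H.f_le v hv' y (.inl (pending_of_duplicate hy))
  · intro y hy; cases hy
  · intro hy; cases hy

theorem pending_expand {y : Node V} : Pending (expand G ω σ x) y ↔ y ∈ σ.opn ∨
    ∃ c, G.Adj x.vertex c ∧ y = ⟨c, some x.vertex, x.g + ω x.vertex c⟩ := by
  simp [Pending, expand]

theorem expand_g_of_ne {v : V} (hv : v ≠ x.vertex) : (expand G ω σ x).g v = σ.g v := by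
  simp [expand, hv]

theorem expand_g_self : (expand G ω σ x).g x.vertex = x.g := by
  simp [expand]

/-- Consistency of the heuristic: all nodes pending after an expansion have `f`-values at least
that of the expanded node. -/
theorem SearchInv.le_f_of_pending_expand (H : SearchInv G ω s t h σ)
    (hcons : IsConsistent G ω t h) (hc : σ.control = .inner x) {y : Node V}
    (hy : Pending (Bela.expand G ω σ x) y) : x.f h ≤ y.f h := by
  rcases pending_expand.1 hy with hy | ⟨c, hxc, rfl⟩
  · exact (H.inner_le x hc).2 y hy
  · have := hcons.2 _ _ hxc
    simp only [Node.f, Nat.cast_add]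
    linarith

theorem SearchInv.expand (H : SearchInv G ω s t h σ) (hfin : ∀ u, {v | G.Adj u v}.Finite)
    (hcons : IsConsistent G ω t h) (hc : σ.control = .inner x)
    (hvt : x.vertex ≠ t) (hv : x.vertex ∉ σ.expanded) : SearchInv G ω s t h (expand G ω σ x) := by
  have hx : Pending σ x := .inr hc
  obtain ⟨hxo, -⟩ := H.inner_le x hc
  have hstart : s ∉ σ.expanded → x = ⟨s, none, 0⟩ := fun hs => H.eq_start hs hx
  have hold : ∀ v ∈ σ.expanded, (Bela.expand G ω σ x).g v = σ.g v := fun v hv' =>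
    expand_g_of_ne fun hvx => hv (hvx ▸ hv')
  refine ⟨?_, ?_, ?_, ?_, ?_, ?_, ?_, ?_, ?_, ?_, ?_, ?_⟩
  · refine H.open_finite.union (((hfin x.vertex).image
      fun c => (⟨c, some x.vertex, x.g + ω x.vertex c⟩ : Node V)).subset ?_)
    rintro y ⟨c, hxc, rfl⟩
    exact ⟨c, hxc, rfl⟩
  · left
    by_cases hs : s ∈ σ.expanded
    · exact .inr hs
    · exact .inl (by rw [hstart hs])
  · intro y hy hyp
    rcases pending_expand.1 hy with hy | ⟨c, hxc, rfl⟩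
    · obtain ⟨hs, rfl⟩ := H.pending_start y (.inl hy) hyp
      exact absurd (hstart hs ▸ hy) hxo
    · cases hyp
  · intro y q hy hq
    rcases pending_expand.1 hy with hy | ⟨c, hxc, rfl⟩
    · obtain ⟨k1, k2, k3, k4⟩ := H.pending_edge y q (.inl hy) hq
      refine ⟨.inr k1, k2, by rw [hold q k1, k3], ?_⟩
      rintro (k | ⟨q', hq', k⟩)
      · exact k4 k
      · obtain ⟨rfl, hk⟩ := Prod.mk.inj k
        have := H.pending_unique hx (.inl hy) hq' hq hk.symm
        exact hxo (this ▸ hy)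
    · obtain rfl : x.vertex = q := by simpa using hq
      refine ⟨.inl rfl, ⟨hxc, hvt⟩, by rw [expand_g_self], ?_⟩
      rintro (k | ⟨q', hq', k⟩)
      · exact hv (H.edge _ _ k).1
      · have := (H.pending_edge x q' hx hq').1
        obtain ⟨k, -⟩ := Prod.mk.inj k
        exact hv (k ▸ this)
  · rintro q v (rfl | hq) hqv
    · rw [expand_g_self]
      exact .inr (pending_expand.2 (.inr ⟨v, hqv.1, rfl⟩))
    · rw [hold q hq]
      rcases H.frontier q v hq hqv with k | k | k
      · exact .inl (.inl k)
      · exact .inr (.inl (.inl k))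
      · rw [hc] at k
        obtain rfl := Control.inner.inj k
        exact .inl (.inr ⟨q, rfl, rfl⟩)
  · rintro q v (k | ⟨q', hq', k⟩)
    · obtain ⟨k1, k2, k3⟩ := H.edge q v k
      refine ⟨.inr k1, k2, fun hvt' => ?_⟩
      obtain ⟨k4, k5⟩ := k3 hvt'
      exact ⟨.inr k4, by rwa [hold q k1, hold v k4]⟩
    · obtain ⟨rfl, rfl⟩ := Prod.mk.inj k
      obtain ⟨k1, k2, k3, -⟩ := H.pending_edge x _ hx hq'
      exact ⟨.inr k1, k2, fun _ => ⟨.inl rfl, by rw [hold _ k1, expand_g_self, k3]⟩⟩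
  · rintro (k | k)
    · exact hvt k.symm
    · exact H.goal_not_expanded k
  · by_cases hs : s ∈ σ.expanded
    · rw [hold s hs, H.g_start]
    · have := hstart hs
      subst this
      exact expand_g_self
  · rintro v (rfl | hv')
    · rw [expand_g_self]
      cases hp : x.parent with
      | none =>
        obtain ⟨-, rfl⟩ := H.pending_start x hx hp
        exact ⟨[s], .refl _ _, rfl⟩
      | some p =>
        obtain ⟨k1, k2, k3, -⟩ := H.pending_edge x _ hx hp
        obtain ⟨π, hπ, hcost⟩ := H.path p k1
        exact ⟨_, hπ.snoc k2, by rw [hπ.cost_snoc, hcost, k3]⟩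
    · rw [hold v hv']
      exact H.path v hv'
  · rintro v (rfl | hv') y hy
    · rw [expand_g_self]
      exact H.le_f_of_pending_expand hcons hc hy
    · rw [hold v hv']
      exact (H.f_le v hv' x hx).trans (H.le_f_of_pending_expand hcons hc hy)
  · intro y hy; cases hy
  · intro hy; cases hy

/-- The key property of the search: a path from `s` is stored completely, and then it is no shorter
than the recorded `g`-value, or a pending node continues its stored part, and then the `f`-value of
that node does not exceed the cost of the path plus the heuristic value of its end. -/
theorem SearchInv.stored_or_pending (H : SearchInv G ω s t h σ) (hcons : IsConsistent G ω t h)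
    {v : V} {π : List V} (hπ : IsPath (stopAt G t) s v π) :
    (π.IsChain (fun a b => (a, b) ∈ σ.edges) ∧ (v ≠ t → v ∈ σ.expanded ∧ σ.g v ≤ pathCost ω π)) ∨
      ∃ x, Pending σ x ∧ x.f h ≤ pathCost ω π + h v := by
  refine IsPath.snoc_induction (motive := fun v π =>
    (π.IsChain (fun a b => (a, b) ∈ σ.edges) ∧ (v ≠ t → v ∈ σ.expanded ∧ σ.g v ≤ pathCost ω π)) ∨
      ∃ x, Pending σ x ∧ x.f h ≤ pathCost ω π + h v) ?_ ?_ hπ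
  · rcases H.start with hs | ⟨-, hs⟩
    · exact .inl ⟨by simp, fun _ => ⟨hs, by simp [H.g_start]⟩⟩
    · exact .inr ⟨_, hs, by simp [Node.f]⟩
  · intro u v π hπ huv ih
    rw [hπ.cost_snoc]
    have hc := hcons.2 u v huv.1
    rcases ih with ⟨hchain, hu⟩ | ⟨x, hx, hf⟩
    · obtain ⟨hue, hgu⟩ := hu huv.2
      rcases H.frontier u v hue huv with hE | hp
      · left
        refine ⟨hchain.append (by simp) ?_, fun hv => ?_⟩
        · intro a ha b hb
          obtain rfl : u = a := by simpa [hπ.2.2] using ha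
          obtain rfl : v = b := by simpa using hb
          exact hE
        · obtain ⟨k1, k2⟩ := (H.edge u v hE).2.2 hv
          exact ⟨k1, by omega⟩
      · right
        refine ⟨_, hp, ?_⟩
        simp only [Node.f]
        gcongr
    · right
      refine ⟨x, hx, ?_⟩
      push_cast
      linarith

/-- The `g`-values of expanded vertices are optimal. -/
theorem SearchInv.g_eq_gStar (H : SearchInv G ω s t h σ) (hcons : IsConsistent G ω t h) {v : V}
    (hv : v ∈ σ.expanded) : σ.g v = gStar (stopAt G t) ω s v := by
  obtain ⟨π, hπ, hcost⟩ := H.path v hv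
  refine le_antisymm ?_ (hcost ▸ gStar_le hπ)
  refine le_csInf ⟨_, π, hπ, rfl⟩ ?_
  rintro _ ⟨π', hπ', rfl⟩
  rcases H.stored_or_pending hcons hπ' with ⟨-, hk⟩ | ⟨x, hx, hf⟩
  · exact (hk fun hvt => H.goal_not_expanded (hvt ▸ hv)).2
  · have := le_of_add_le_add_right ((H.f_le v hv x hx).trans hf)
    exact_mod_cast this

/-- Along a stored path, the recorded `g`-values are at most the cost of the way so far. -/
theorem SearchInv.g_le_of_stored (H : SearchInv G ω s t h σ) {v : V} {π : List V}
    (hπ : IsPath (stopAt G t) s v π) (hv : v ≠ t)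
    (hchain : π.IsChain (fun a b => (a, b) ∈ σ.edges)) : σ.g v ≤ pathCost ω π := by
  revert hv hchain
  refine IsPath.snoc_induction (motive := fun v π => v ≠ t → π.IsChain _ →
    σ.g v ≤ pathCost ω π) ?_ ?_ hπ
  · exact fun _ _ => by simp [H.g_start]
  · intro u v π hπ huv ih hv hchain
    have hE : (u, v) ∈ σ.edges :=
      (List.isChain_append.1 hchain).2.2 u (by simp [hπ.2.2]) v (by simp)
    have k := ih huv.2 hchain.left_of_append
    have := ((H.edge u v hE).2.2 hv).2
    rw [hπ.cost_snoc]
    omega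

end Search

/-! ### Backward costs, centroids, and the paths found -/

/-- The invariant of the centroids. A backward cost `c` known at `v` is the cost of a path from `v` to
the goal; the overall cost `σ.g v + c` is a lower bound for everything that is still to be processed.
Backward costs travel against the stored edges: along each edge, a cost known at its end is known at
its source as well, or there is a pending centroid that will take it there (`transfer`). A completely
stored path has been found, or one of its edges has a pending centroid, whose cost is that of the
remaining path added to the `g`-value of the source (`complete`). -/
structure CentroidInv (G : Digraph V) (ω : V → V → ℕ) (s t : V) (h : V → ℝ≥0) (σ : State V) :
    Prop where
  goal_value : ∀ c, c ∈ σ.gb t ↔ c = 0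
  value : ∀ v c, c ∈ σ.gb v → v ≠ t →
    v ∈ σ.expanded ∧ ∃ π, IsPath (stopAt G t) v t π ∧ pathCost ω π = c
  value_le_pending : ∀ v c x, c ∈ σ.gb v → v ≠ t → Pending σ x →
    ((σ.g v + c : ℕ) : ℝ≥0) ≤ x.f h
  value_le_centroid : ∀ v c z, c ∈ σ.gb v → v ≠ t → z ∈ σ.Z → σ.g v + c ≤ z.cost
  centroid : ∀ z ∈ σ.Z, (z.src, z.dst) ∈ σ.edges ∧
    ∃ c ∈ σ.gb z.dst, z.cost = σ.g z.src + ω z.src z.dst + c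
  sidetrack : (∀ v, h v = 0) → ∀ z ∈ σ.Z, z.dst ≠ t → σ.g z.dst < σ.g z.src + ω z.src z.dst
  transfer : ∀ p v c, (p, v) ∈ σ.edges → c ∈ σ.gb v →
    c + ω p v ∈ σ.gb p ∨ ⟨p, v, σ.g p + ω p v + c⟩ ∈ σ.Z
  complete : ∀ π, IsPath (stopAt G t) s t π → π.IsChain (fun a b => (a, b) ∈ σ.edges) →
    (∀ α u v β, π = α ++ u :: v :: β → ⟨u, v, σ.g u + ω u v + pathCost ω (v :: β)⟩ ∉ σ.Z) →
    π ∈ σ.found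
  sound : σ.found ⊆ solutionPaths (stopAt G t) s t
  admissible : ∀ π ∈ σ.found, ∀ π' ∈ solutionPaths (stopAt G t) s t,
    pathCost ω π' < pathCost ω π → π' ∈ σ.found

section Centroids

variable {G : Digraph V} {ω : V → V → ℕ} {s t : V} {h : V → ℝ≥0} {σ σ' : State V} {x : Node V}
  {z : Centroid V}

/-- If no centroid is pending along a stored path to the goal, the costs of all its final parts
have reached their vertices. -/
theorem pathCost_mem_gb (h0 : 0 ∈ σ.gb t)
    (htransfer : ∀ p v c, (p, v) ∈ σ.edges → c ∈ σ.gb v →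
      c + ω p v ∈ σ.gb p ∨ ⟨p, v, σ.g p + ω p v + c⟩ ∈ σ.Z)
    {v : V} {π : List V} (hπ : IsPath (stopAt G t) v t π)
    (hchain : π.IsChain (fun a b => (a, b) ∈ σ.edges))
    (hno : ∀ α u w β, π = α ++ u :: w :: β →
      ⟨u, w, σ.g u + ω u w + pathCost ω (w :: β)⟩ ∉ σ.Z) : pathCost ω π ∈ σ.gb v := by
  revert hchain hno
  refine IsPath.cons_induction (motive := fun v π => π.IsChain _ →
    (∀ α u w β, π = α ++ u :: w :: β →
      ⟨u, w, σ.g u + ω u w + pathCost ω (w :: β)⟩ ∉ σ.Z) → pathCost ω π ∈ σ.gb v) ?_ ?_ hπ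
  · exact fun _ _ => h0
  · intro u v l huv _ ih hchain hno
    obtain ⟨hE, hchain'⟩ := List.isChain_cons_cons.1 hchain
    have hc := ih hchain' fun α a w β hl => hno (u :: α) a w β (by rw [hl]; rfl)
    rcases htransfer u v _ hE hc with hk | hk
    · rwa [add_comm] at hk
    · exact absurd hk (hno [] u v l rfl)

/-- The depth-first search delivers every stored path along which all backward costs are known. -/
theorem isSuffix_of_gb {v : V} {π : List V} (hπ : IsPath (stopAt G t) v t π)
    (hchain : π.IsChain (fun a b => (a, b) ∈ σ.edges))
    (hgb : ∀ α u β, π = α ++ u :: β → pathCost ω (u :: β) ∈ σ.gb u) :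
    IsSuffix ω t σ v (pathCost ω π) π := by
  revert hchain hgb
  refine IsPath.cons_induction (motive := fun v π => π.IsChain _ →
    (∀ α u β, π = α ++ u :: β → pathCost ω (u :: β) ∈ σ.gb u) →
      IsSuffix ω t σ v (pathCost ω π) π) ?_ ?_ hπ
  · exact fun _ _ => .goal
  · intro u v l huv _ ih hchain hgb
    obtain ⟨hE, hchain'⟩ := List.isChain_cons_cons.1 hchain
    have hs := ih hchain' fun α a β hl => hgb (u :: α) a β (by rw [hl]; rfl)
    rw [pathCost, add_comm]
    exact .cons huv.2 hE (hgb [u] v l rfl) hs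

theorem SearchInv.isPath_of_isPrefix (H : SearchInv G ω s t h σ) {v : V} {φ : List V}
    (hφ : IsPrefix ω s σ v φ) : IsPath (stopAt G t) s v φ ∧ pathCost ω φ = σ.g v := by
  induction hφ with
  | start => exact ⟨.refl _ _, H.g_start.symm⟩
  | snoc _ hE hg _ ih => exact ⟨ih.1.snoc (H.edge _ _ hE).2.1, by rw [ih.1.cost_snoc, ih.2, hg]⟩

theorem isPath_of_isSuffix (hE : ∀ u v, (u, v) ∈ σ.edges → (stopAt G t).Adj u v)
    {v : V} {c : ℕ} {τ : List V} (hτ : IsSuffix ω t σ v c τ) :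
    IsPath (stopAt G t) v t τ ∧ pathCost ω τ = c := by
  induction hτ with
  | goal => exact ⟨.refl _ _, rfl⟩
  | cons _ huv _ _ ih =>
    have huv' := hE _ _ huv
    exact ⟨(IsPath.refl _ _).append huv' ih.1,
      by rw [← List.singleton_append, (IsPath.refl _ _).cost_append ih.1, ih.2]
         simp [pathCost, add_comm]⟩

theorem SearchInv.isPath_of_mem_getPaths (H : SearchInv G ω s t h σ)
    (hz : (z.src, z.dst) ∈ σ.edges) {π : List V} (hπ : π ∈ getPaths ω s t σ z) :
    IsPath (stopAt G t) s t π ∧ pathCost ω π = z.cost := by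
  obtain ⟨φ, τ, c, hφ, hτ, hc, rfl⟩ := hπ
  obtain ⟨h1, h2⟩ := H.isPath_of_isPrefix hφ
  obtain ⟨k1, k2⟩ := isPath_of_isSuffix (σ := afterPrefixes ω s σ z)
    (fun u v hE => (H.edge u v hE).2.1) hτ
  exact ⟨h1.append (H.edge _ _ hz).2.1 k1, by rw [h1.cost_append k1, h2, k2, hc]⟩

theorem CentroidInv.initial (hst : s ≠ t) : CentroidInv G ω s t h (initial s t) where
  goal_value := fun c => by simp [Bela.initial]
  value := fun v c hc hv => absurd hc.1 hv
  value_le_pending := fun v c _ hc hv => absurd hc.1 hv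
  value_le_centroid := fun v c _ hc hv => absurd hc.1 hv
  centroid := fun _ hz => hz.elim
  sidetrack := fun _ _ hz => hz.elim
  transfer := fun _ _ _ hE => hE.elim
  complete := by
    intro π hπ hchain _
    match π, hπ, hchain with
    | [], hπ, _ => simp [IsPath] at hπ
    | [v], hπ, _ =>
      obtain rfl : v = s := by simpa using hπ.2.1
      exact absurd (by simpa using hπ.2.2) hst
    | u :: v :: l, _, hchain => exact (List.isChain_cons_cons.1 hchain).1.elim
  sound := fun _ hπ => hπ.elim
  admissible := fun _ hπ => hπ.elim

theorem CentroidInv.pop (H : CentroidInv G ω s t h σ) (hc : σ.control = .outer)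
    (hx : x ∈ σ.opn) : CentroidInv G ω s t h { σ with opn := σ.opn \ {x}, control := .inner x } where
  goal_value := H.goal_value
  value := H.value
  value_le_pending := by simpa only [pending_pop hc hx] using H.value_le_pending
  value_le_centroid := H.value_le_centroid
  centroid := H.centroid
  sidetrack := H.sidetrack
  transfer := H.transfer
  complete := H.complete
  sound := H.sound
  admissible := H.admissible

theorem CentroidInv.exhausted (H : CentroidInv G ω s t h σ) (hc : σ.control = .outer) :
    CentroidInv G ω s t h { σ with control := .final } where
  goal_value := H.goal_value
  value := H.value
  value_le_pending := by simpa only [pending_exhausted hc] using H.value_le_pending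
  value_le_centroid := H.value_le_centroid
  centroid := H.centroid
  sidetrack := H.sidetrack
  transfer := H.transfer
  complete := H.complete
  sound := H.sound
  admissible := H.admissible

/-- A solution path that has not been found is announced by a pending node or a pending centroid of
no greater value. -/
theorem CentroidInv.exists_pending_or_centroid (H : CentroidInv G ω s t h σ)
    (HS : SearchInv G ω s t h σ) (hcons : IsConsistent G ω t h) {π : List V}
    (hπ : π ∈ solutionPaths (stopAt G t) s t) (hnot : π ∉ σ.found) :
    (∃ x, Pending σ x ∧ x.f h ≤ pathCost ω π) ∨ ∃ z ∈ σ.Z, z.cost ≤ pathCost ω π := by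
  rcases HS.stored_or_pending hcons hπ with ⟨hchain, -⟩ | ⟨x, hx, hf⟩
  · right
    by_contra! hZ
    refine hnot (H.complete π hπ hchain ?_)
    rintro α u v β rfl hz
    have hlt := hZ _ hz
    have hpre : IsPath (stopAt G t) s u (α ++ [u]) := IsPath.prefix hπ
    have hg := HS.g_le_of_stored hpre (IsPath.adj hπ).2
      (List.IsChain.prefix hchain ⟨v :: β, by simp⟩)
    rw [pathCost_append_cons, pathCost] at hlt
    simp only at hlt
    omega
  · exact .inl ⟨x, hx, by simpa [hcons.1] using hf⟩

/-- Backward costs, also that of the goal, are costs of paths to the goal. -/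
theorem CentroidInv.value' (H : CentroidInv G ω s t h σ) {v : V} {c : ℕ} (hc : c ∈ σ.gb v) :
    ∃ π, IsPath (stopAt G t) v t π ∧ pathCost ω π = c := by
  by_cases hv : v = t
  · subst hv
    exact ⟨[v], .refl _ _, ((H.goal_value c).1 hc).symm⟩
  · exact (H.value v c hc hv).2

/-- The cost of a pending centroid is the cost of some solution path. -/
theorem CentroidInv.exists_path_of_centroid (H : CentroidInv G ω s t h σ)
    (HS : SearchInv G ω s t h σ) (hz : z ∈ σ.Z) :
    ∃ π ∈ solutionPaths (stopAt G t) s t, pathCost ω π = z.cost := by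
  obtain ⟨hE, c, hc, hcost⟩ := H.centroid z hz
  obtain ⟨hsrc, hadj, -⟩ := HS.edge _ _ hE
  obtain ⟨φ, hφ, hφc⟩ := HS.path _ hsrc
  obtain ⟨τ, hτ, hτc⟩ := H.value' hc
  exact ⟨φ ++ τ, hφ.append hadj hτ, by rw [hφ.cost_append hτ, hφc, hτc, hcost]⟩

/-! ### Processing a centroid -/

/-- The state after a centroid has been processed, apart from the test whether to return. -/
def collect (ω : V → V → ℕ) (s t : V) (σ : State V) (z : Centroid V) : State V :=
  { afterPrefixes ω s σ z with found := σ.found ∪ getPaths ω s t σ z }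

theorem consume_eq (κ : ℕ) (hκ : (σ.found ∪ getPaths ω s t σ z).encard < κ) :
    consume ω s t κ σ z = collect ω s t σ z := by
  simp only [consume, collect, not_le.2 hκ, if_false]
  rfl

theorem SearchInv.collect (H : SearchInv G ω s t h σ) :
    SearchInv G ω s t h (collect ω s t σ z) :=
  H.congr rfl rfl rfl rfl rfl

/-- A centroid that may be processed costs no more than any pending node. -/
theorem MayConsume.le_f (hz : MayConsume h σ z) (HS : SearchInv G ω s t h σ)
    (hx : Pending σ x) : (z.cost : ℝ≥0) ≤ x.f h := by
  obtain ⟨-, -, hc | ⟨n, hc, hle⟩⟩ := hz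
  · rcases hx with hx | hx
    · simp [HS.final hc] at hx
    · simp [hc] at hx
  · rcases hx with hx | hx
    · exact hle.trans ((HS.inner_le n hc).2 x hx)
    · rw [hc] at hx
      obtain rfl := Control.inner.inj hx
      exact hle

/-- All calls of `GetPrefixes` in the processing of the centroid `z` have the overall cost of `z`, and
their values are costs of paths to the goal. -/
theorem CentroidInv.prefixCall (H : CentroidInv G ω s t h σ) (HS : SearchInv G ω s t h σ)
    (hz : z ∈ σ.Z) {n : V} {c : ℕ}
    (hcall : PrefixCall ω s { σ with Z := σ.Z \ {z} } z.src (z.cost - σ.g z.src) n c) :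
    n ≠ t ∧ n ∈ σ.expanded ∧ σ.g n + c = z.cost ∧
      ∃ π, IsPath (stopAt G t) n t π ∧ pathCost ω π = c := by
  induction hcall with
  | base =>
    obtain ⟨hE, c, hc, hcost⟩ := H.centroid z hz
    obtain ⟨hsrc, hadj, -⟩ := HS.edge _ _ hE
    obtain ⟨τ, hτ, hτc⟩ := H.value' hc
    refine ⟨hadj.2, hsrc, by omega, _, (IsPath.refl _ _).append hadj hτ, ?_⟩
    rw [(IsPath.refl _ _).cost_append hτ, hτc, hcost]
    simp only [pathCost]
    omega
  | @step n p c _ _ hE hg ih =>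
    obtain ⟨hp, hadj, -⟩ := HS.edge _ _ hE
    obtain ⟨-, -, hcost, τ, hτ, hτc⟩ := ih
    refine ⟨hadj.2, hp, ?_, _, (IsPath.refl _ _).append hadj hτ, ?_⟩
    · simp only at hg
      omega
    · rw [(IsPath.refl _ _).cost_append hτ, hτc]
      simp only [pathCost]
      omega

theorem CentroidInv.transfer_collect (H : CentroidInv G ω s t h σ) (HS : SearchInv G ω s t h σ)
    (hω : ∀ u v, G.Adj u v → 0 < ω u v) (hz : z ∈ σ.Z) (p v : V) (c : ℕ)
    (hE : (p, v) ∈ (Bela.collect ω s t σ z).edges) (hc : c ∈ (Bela.collect ω s t σ z).gb v) :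
    c + ω p v ∈ (Bela.collect ω s t σ z).gb p ∨
      ⟨p, v, (Bela.collect ω s t σ z).g p + ω p v + c⟩ ∈ (Bela.collect ω s t σ z).Z := by
  change (p, v) ∈ σ.edges at hE
  by_cases hold : c ∈ σ.gb v
  · rcases H.transfer p v c hE hold with hk | hk
    · exact .inl (.inl hk)
    -- if the pending centroid is `z` itself, it is the first call of `GetPrefixes` that takes
    -- the cost to `p`
    · by_cases heq : (⟨p, v, σ.g p + ω p v + c⟩ : Centroid V) = z
      · left; right
        subst heq
        have : c + ω p v = σ.g p + ω p v + c - σ.g p := by omega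
        rw [this]
        exact .base
      · exact .inr (.inl ⟨hk, heq⟩)
  · have hcall := hc.resolve_left hold
    have hvt := (H.prefixCall HS hz hcall).1
    obtain ⟨-, hadj, hv⟩ := HS.edge p v hE
    rcases (hv hvt).2.lt_or_eq with hlt | heq
    · exact .inr (.inr ⟨p, v, c, hcall, hold, hE, hlt, rfl⟩)
    · refine .inl (.inr (PrefixCall.step hcall ?_ hE heq.symm))
      rintro rfl
      have := hω _ _ hadj.1
      have := HS.g_start
      omega

/-- A known backward cost, old or new, has an overall cost of at most that of the centroid being
processed. -/
theorem CentroidInv.le_cost_of_mem_gb_collect (H : CentroidInv G ω s t h σ)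
    (HS : SearchInv G ω s t h σ) (hz : z ∈ σ.Z) {v : V} {c : ℕ}
    (hc : c ∈ (Bela.collect ω s t σ z).gb v) (hv : v ≠ t) : σ.g v + c ≤ z.cost := by
  rcases hc with hc | hc
  · exact H.value_le_centroid v c z hc hv hz
  · exact (H.prefixCall HS hz hc).2.2.1.le

/-- Processing a cheapest centroid leaves no cheaper one. -/
theorem CentroidInv.cost_le_of_mem_collect (H : CentroidInv G ω s t h σ)
    (HS : SearchInv G ω s t h σ) (hz : z ∈ σ.Z) (hmin : ∀ z' ∈ σ.Z, z.cost ≤ z'.cost)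
    {z' : Centroid V} (hz' : z' ∈ (Bela.collect ω s t σ z).Z) : z.cost ≤ z'.cost := by
  rcases hz' with hz' | ⟨p, n, c, hcall, -, -, hlt, rfl⟩
  · exact hmin z' hz'.1
  · have := (H.prefixCall HS hz hcall).2.2.1
    simp only at hlt ⊢
    omega

/-- When the last pending centroid along a completely stored path is processed, the path is found.
Its part after the centroid's edge is a suffix, because all backward costs along the path are known.
Its part before the edge is a prefix: `GetPrefixes` carries the cost backwards along the path, and the
first sidetrack edge met on the way would get a new centroid, since a backward cost known at its
source would exceed the cost of the processed centroid. -/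
theorem CentroidInv.complete_collect (H : CentroidInv G ω s t h σ) (HS : SearchInv G ω s t h σ)
    (hω : ∀ u v, G.Adj u v → 0 < ω u v) (hz : z ∈ σ.Z)
    {π : List V} (hπ : IsPath (stopAt G t) s t π)
    (hchain : π.IsChain (fun a b => (a, b) ∈ (Bela.collect ω s t σ z).edges))
    (hno : ∀ α u v β, π = α ++ u :: v :: β →
      ⟨u, v, (Bela.collect ω s t σ z).g u + ω u v + pathCost ω (v :: β)⟩ ∉
        (Bela.collect ω s t σ z).Z) :
    π ∈ (Bela.collect ω s t σ z).found := by
  by_cases hall : ∀ α u v β, π = α ++ u :: v :: β →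
      ⟨u, v, σ.g u + ω u v + pathCost ω (v :: β)⟩ ∉ σ.Z
  · exact .inl (H.complete π hπ hchain hall)
  push Not at hall
  obtain ⟨α, u, v, β, rfl, hmem⟩ := hall
  have hno' := hno α u v β rfl
  have heq : (⟨u, v, σ.g u + ω u v + pathCost ω (v :: β)⟩ : Centroid V) = z := by
    by_contra hne
    exact hno' (.inl ⟨hmem, hne⟩)
  right
  have hgb : ∀ α' u' β', α ++ u :: v :: β = α' ++ u' :: β' →
      pathCost ω (u' :: β') ∈ (Bela.collect ω s t σ z).gb u' := by
    intro α' u' β' hl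
    refine pathCost_mem_gb (σ := Bela.collect ω s t σ z) (G := G)
      (.inl ((H.goal_value 0).2 rfl)) (H.transfer_collect HS hω hz)
      (IsPath.suffix (α := α') (hl ▸ hπ)) (List.IsChain.right_of_append (hl ▸ hchain)) ?_
    intro α'' a w β'' hl'
    exact hno (α' ++ α'') a w β'' (by rw [hl, hl', List.append_assoc])
  have hpre : ∀ (α : List V) (u : V) (β : List V), IsPath (stopAt G t) s t (α ++ u :: β) →
      (α ++ u :: β).IsChain (fun a b => (a, b) ∈ σ.edges) →
      (∀ α' u' v' β', α ++ u :: β = α' ++ u' :: v' :: β' →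
        ⟨u', v', σ.g u' + ω u' v' + pathCost ω (v' :: β')⟩ ∉ (Bela.collect ω s t σ z).Z) →
      PrefixCall ω s { σ with Z := σ.Z \ {z} } z.src (z.cost - σ.g z.src) u
        (pathCost ω (u :: β)) → IsPrefix ω s σ u (α ++ [u]) := by
    intro α
    induction α using List.reverseRecOn with
    | nil =>
      intro u β hπ _ _ _
      obtain rfl : u = s := by simpa using hπ.2.1
      exact .start
    | append_singleton α w ih =>
      intro u β hπ hchain hno hcall
      rw [List.append_assoc, List.singleton_append] at hπ hchain hno
      obtain ⟨hut, -, hcost, -⟩ := H.prefixCall HS hz hcall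
      have hE : (w, u) ∈ σ.edges := (List.isChain_cons_cons.1 hchain.right_of_append).1
      obtain ⟨-, hadj, hu⟩ := HS.edge w u hE
      have hnot := hno α w u β rfl
      rcases (hu hut).2.lt_or_eq with hlt | hg
      -- the edge would be a sidetrack edge with a centroid that is pending afterwards
      · exfalso
        by_cases hold : pathCost ω (u :: β) ∈ σ.gb u
        · rcases H.transfer w u _ hE hold with hk | hk
          · have := H.value_le_centroid w _ z hk hadj.2 hz
            omega
          · refine hnot (.inl ⟨hk, ?_⟩)
            intro hk'
            have : σ.g w + ω w u + pathCost ω (u :: β) = z.cost := by rw [← hk']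
            omega
        · exact hnot (.inr ⟨w, u, _, hcall, hold, hE, hlt, rfl⟩)
      · have hus : u ≠ s := by
          rintro rfl
          have := hω _ _ hadj.1
          have := HS.g_start
          omega
        refine .snoc hus hE hg.symm (ih w (u :: β) hπ hchain hno ?_)
        rw [pathCost, add_comm]
        exact .step hcall hus hE hg.symm
  have hcost : z.cost = σ.g u + ω u v + pathCost ω (v :: β) := by rw [← heq]
  have hsrc : z.src = u := by rw [← heq]
  have hdst : z.dst = v := by rw [← heq]
  refine ⟨α ++ [u], v :: β, pathCost ω (v :: β), ?_, ?_, ?_, by simp⟩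
  · rw [hsrc]
    refine hpre α u (v :: β) hπ hchain hno ?_
    have : pathCost ω (u :: v :: β) = z.cost - σ.g z.src := by rw [pathCost, hcost, hsrc]; omega
    rw [this, hsrc]
    exact .base
  · rw [hdst]
    have hπ' : IsPath (stopAt G t) s t ((α ++ [u]) ++ v :: β) := by simpa using hπ
    refine isSuffix_of_gb (G := G) hπ'.suffix ?_ ?_
    · exact (List.isChain_cons_cons.1 hchain.right_of_append).2
    · intro α' u' β' hl
      exact hgb (α ++ u :: α') u' β' (by rw [hl]; simp)
  · rw [hcost, hsrc, hdst]

theorem CentroidInv.collect (H : CentroidInv G ω s t h σ) (HS : SearchInv G ω s t h σ)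
    (hω : ∀ u v, G.Adj u v → 0 < ω u v) (hcons : IsConsistent G ω t h)
    (hz : MayConsume h σ z) : CentroidInv G ω s t h (collect ω s t σ z) where
  goal_value := by
    intro c
    rw [← H.goal_value c]
    exact ⟨fun hc => hc.resolve_right fun hc => (H.prefixCall HS hz.1 hc).1 rfl, .inl⟩
  value := by
    rintro v c (hc | hc) hv
    · exact H.value v c hc hv
    · exact (H.prefixCall HS hz.1 hc).2.imp id And.right
  value_le_pending := by
    intro v c x hc hv hx
    refine le_trans ?_ (hz.le_f HS hx)
    exact_mod_cast H.le_cost_of_mem_gb_collect HS hz.1 hc hv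
  value_le_centroid := fun v c z' hc hv hz' =>
    (H.le_cost_of_mem_gb_collect HS hz.1 hc hv).trans (H.cost_le_of_mem_collect HS hz.1 hz.2.1 hz')
  centroid := by
    rintro z' (hz' | ⟨p, n, c, hcall, -, hE, -, rfl⟩)
    · obtain ⟨hE, c, hc, hcost⟩ := H.centroid z' hz'.1
      exact ⟨hE, c, .inl hc, hcost⟩
    · exact ⟨hE, c, .inr hcall, rfl⟩
  sidetrack := by
    rintro h0 z' (hz' | ⟨p, n, c, -, -, -, hlt, rfl⟩) hdst
    · exact H.sidetrack h0 z' hz'.1 hdst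
    · exact hlt
  transfer := H.transfer_collect HS hω hz.1
  complete := fun π hπ hchain hno => H.complete_collect HS hω hz.1 hπ hchain hno
  sound := by
    rintro π (hπ | hπ)
    · exact H.sound hπ
    · exact (HS.isPath_of_mem_getPaths (H.centroid z hz.1).1 hπ).1
  admissible := by
    rintro π (hπ | hπ) π' hπ' hlt
    · exact .inl (H.admissible π hπ π' hπ' hlt)
    · left
      rw [(HS.isPath_of_mem_getPaths (H.centroid z hz.1).1 hπ).2] at hlt
      by_contra hnot
      rcases H.exists_pending_or_centroid HS hcons hπ' hnot with ⟨x, hx, hf⟩ | ⟨z', hz', hf⟩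
      · have := (hz.le_f HS hx).trans hf
        rw [Nat.cast_le] at this
        omega
      · have := hz.2.1 z' hz'
        omega

/-! ### Storing an edge -/

theorem CentroidInv.heuristic_le (H : CentroidInv G ω s t h σ) (hcons : IsConsistent G ω t h)
    {v : V} {c : ℕ} (hc : c ∈ σ.gb v) : h v ≤ c := by
  obtain ⟨π, hπ, rfl⟩ := H.value' hc
  have := heuristic_le_of_isPath (G := stopAt G t) (h := h) (fun u v huv => hcons.2 u v huv.1) hπ
  simpa [hcons.1] using this

/-- Popping a copy of the goal is a special case of popping a copy of an expanded vertex, as `0` is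
the only backward cost of the goal. -/
theorem CentroidInv.reachGoal_eq (H : CentroidInv G ω s t h σ) (HS : SearchInv G ω s t h σ)
    (hc : σ.control = .inner x) (hv : x.vertex = t) : reachGoal t σ x = duplicate ω σ x := by
  simp only [reachGoal, duplicate, hv]
  congr 2
  ext z
  simp only [Set.mem_ofPred_eq]
  refine exists_congr fun p => ⟨?_, ?_⟩
  · rintro ⟨hp, rfl⟩
    exact ⟨0, hp, (H.goal_value 0).2 rfl, by rw [(HS.pending_edge x p (.inr hc) hp).2.2.1, hv]; rfl⟩
  · rintro ⟨c, hp, hc', rfl⟩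
    obtain rfl := (H.goal_value c).1 hc'
    exact ⟨hp, by rw [(HS.pending_edge x p (.inr hc) hp).2.2.1, hv]; rfl⟩

theorem CentroidInv.duplicate (H : CentroidInv G ω s t h σ) (HS : SearchInv G ω s t h σ)
    (hω : ∀ u v, G.Adj u v → 0 < ω u v) (hcons : IsConsistent G ω t h)
    (hctl : σ.control = .inner x) : CentroidInv G ω s t h (duplicate ω σ x) := by
  have hx : Pending σ x := .inr hctl
  have htransfer : ∀ p v c, (p, v) ∈ (Bela.duplicate ω σ x).edges →
      c ∈ (Bela.duplicate ω σ x).gb v → c + ω p v ∈ (Bela.duplicate ω σ x).gb p ∨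
        ⟨p, v, (Bela.duplicate ω σ x).g p + ω p v + c⟩ ∈ (Bela.duplicate ω σ x).Z := by
    rintro p v c (hE | ⟨q, hq, hE⟩) hc
    · exact (H.transfer p v c hE hc).imp id .inl
    · obtain ⟨rfl, rfl⟩ := Prod.mk.inj hE
      exact .inr (.inr ⟨p, c, hq, hc, rfl⟩)
  refine ⟨H.goal_value, H.value, ?_, ?_, ?_, ?_, htransfer, ?_, H.sound, H.admissible⟩
  · exact fun v c y hc hv hy => H.value_le_pending v c y hc hv (.inl (pending_of_duplicate hy))
  · rintro v c z hc hv (hz | ⟨p, c', hp, hc', rfl⟩)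
    · exact H.value_le_centroid v c z hc hv hz
    · have h1 := H.value_le_pending v c x hc hv hx
      have h2 := H.heuristic_le hcons hc'
      rw [Node.f, (HS.pending_edge x p hx hp).2.2.1] at h1
      have h3 := h1.trans (add_le_add_right h2 _)
      exact_mod_cast h3
  · rintro z (hz | ⟨p, c, hp, hc, rfl⟩)
    · obtain ⟨hE, hc⟩ := H.centroid z hz
      exact ⟨.inl hE, hc⟩
    · exact ⟨.inr ⟨p, hp, rfl⟩, c, hc, rfl⟩
  · rintro h0 z (hz | ⟨p, c, hp, hc, rfl⟩) hdst
    · exact H.sidetrack h0 z hz hdst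
    · simp only at hdst ⊢
      have h1 := H.value_le_pending _ c x hc hdst hx
      rw [Node.f, h0, add_zero, Nat.cast_le, (HS.pending_edge x p hx hp).2.2.1] at h1
      -- a path from `x.vertex` to the goal has at least one edge
      have hpos : 0 < c := by
        obtain ⟨-, π, hπ, rfl⟩ := H.value _ c hc hdst
        revert hdst
        refine IsPath.cons_induction (motive := fun v π => v ≠ t → 0 < pathCost ω π) ?_ ?_ hπ
        · exact fun hne => absurd rfl hne
        · intro u v l huv _ _ _
          have := hω u v huv.1
          rw [pathCost]
          omega
      change σ.g x.vertex < σ.g p + ω p x.vertex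
      omega
  · intro π hπ hchain hno
    by_cases hall : ∀ ⦃a b l₁ l₂⦄, π = l₁ ++ a :: b :: l₂ → (a, b) ∈ σ.edges
    · exact H.complete π hπ (List.isChain_iff_forall_rel_of_append_cons_cons.2 hall)
        fun α u v β hl hz => hno α u v β hl (.inl hz)
    -- the path uses the new edge, for which a centroid is created
    · exfalso
      push Not at hall
      obtain ⟨u, v, α, β, rfl, hE⟩ := hall
      have hE' := (List.isChain_cons_cons.1 hchain.right_of_append).1
      obtain ⟨q, hq, hqe⟩ := hE'.resolve_left hE
      obtain ⟨rfl, rfl⟩ := Prod.mk.inj hqe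
      have hπ' : IsPath (stopAt G t) s t ((α ++ [u]) ++ x.vertex :: β) := by simpa using hπ
      refine hno α u x.vertex β rfl (.inr ⟨u, _, hq, ?_, rfl⟩)
      refine pathCost_mem_gb (σ := Bela.duplicate ω σ x) (G := G) ((H.goal_value 0).2 rfl)
        htransfer hπ'.suffix (List.isChain_cons_cons.1 hchain.right_of_append).2 ?_
      intro α' a w β' hl
      exact hno (α ++ u :: α') a w β' (by rw [hl]; simp)

theorem CentroidInv.expand (H : CentroidInv G ω s t h σ) (HS : SearchInv G ω s t h σ)
    (hcons : IsConsistent G ω t h) (hctl : σ.control = .inner x) (hvt : x.vertex ≠ t)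
    (hv : x.vertex ∉ σ.expanded) : CentroidInv G ω s t h (expand G ω σ x) := by
  have hx : Pending σ x := .inr hctl
  have hold : ∀ v ∈ σ.expanded, (Bela.expand G ω σ x).g v = σ.g v := fun v hv' =>
    expand_g_of_ne fun hvx => hv (hvx ▸ hv')
  have hempty : ∀ c, c ∉ σ.gb x.vertex := fun c hc => hv (H.value _ c hc hvt).1
  have htransfer : ∀ p v c, (p, v) ∈ (Bela.expand G ω σ x).edges →
      c ∈ (Bela.expand G ω σ x).gb v → c + ω p v ∈ (Bela.expand G ω σ x).gb p ∨
        ⟨p, v, (Bela.expand G ω σ x).g p + ω p v + c⟩ ∈ (Bela.expand G ω σ x).Z := by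
    rintro p v c (hE | ⟨q, hq, hE⟩) hc
    · rw [hold p (HS.edge p v hE).1]
      exact H.transfer p v c hE hc
    · obtain ⟨rfl, rfl⟩ := Prod.mk.inj hE
      exact absurd hc (hempty c)
  refine ⟨H.goal_value, ?_, ?_, ?_, ?_, ?_, htransfer, ?_, H.sound, H.admissible⟩
  · exact fun v c hc hv' => (H.value v c hc hv').imp .inr id
  · intro v c y hc hv' hy
    rw [hold v (H.value v c hc hv').1]
    exact (H.value_le_pending v c x hc hv' hx).trans (HS.le_f_of_pending_expand hcons hctl hy)
  · intro v c z hc hv' hz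
    rw [hold v (H.value v c hc hv').1]
    exact H.value_le_centroid v c z hc hv' hz
  · intro z hz
    obtain ⟨hE, hc⟩ := H.centroid z hz
    rw [hold _ (HS.edge _ _ hE).1]
    exact ⟨.inl hE, hc⟩
  · intro h0 z hz hdst
    have hE := HS.edge _ _ (H.centroid z hz).1
    rw [hold _ hE.1, hold _ (hE.2.2 hdst).1]
    exact H.sidetrack h0 z hz hdst
  · intro π hπ hchain hno
    by_cases hall : ∀ ⦃a b l₁ l₂⦄, π = l₁ ++ a :: b :: l₂ → (a, b) ∈ σ.edges
    · refine H.complete π hπ (List.isChain_iff_forall_rel_of_append_cons_cons.2 hall) ?_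
      intro α u v β hl
      rw [← hold u (HS.edge u v (hall hl)).1]
      exact hno α u v β hl
    -- the path uses the new edge, but no backward cost is known yet at the end of that edge
    · exfalso
      push Not at hall
      obtain ⟨u, v, α, β, rfl, hE⟩ := hall
      have hE' := (List.isChain_cons_cons.1 hchain.right_of_append).1
      obtain ⟨q, hq, hqe⟩ := hE'.resolve_left hE
      obtain ⟨rfl, rfl⟩ := Prod.mk.inj hqe
      have hπ' : IsPath (stopAt G t) s t ((α ++ [u]) ++ x.vertex :: β) := by simpa using hπ
      refine hempty (pathCost ω (x.vertex :: β)) ?_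
      refine pathCost_mem_gb (σ := Bela.expand G ω σ x) (G := G) ((H.goal_value 0).2 rfl)
        htransfer hπ'.suffix (List.isChain_cons_cons.1 hchain.right_of_append).2 ?_
      intro α' a w β' hl
      exact hno (α ++ u :: α') a w β' (by rw [hl]; simp)

end Centroids

/-! ### Executions -/

/-- The invariant of an execution that has not returned yet. -/
structure RunInv (G : Digraph V) (ω : V → V → ℕ) (s t : V) (κ : ℕ) (h : V → ℝ≥0) (σ : State V) :
    Prop where
  search : SearchInv G ω s t h σ
  centroids : CentroidInv G ω s t h σ
  found_lt : σ.found.encard < κ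
  not_halted : σ.control ≠ .halted

/-- What is known of the paths found when the execution returns. -/
structure Returned (G : Digraph V) (ω : V → V → ℕ) (s t : V) (κ : ℕ) (σ : State V) : Prop where
  halted : σ.control = .halted
  sound : σ.found ⊆ solutionPaths (stopAt G t) s t
  admissible : ∀ π ∈ σ.found, ∀ π' ∈ solutionPaths (stopAt G t) s t,
    pathCost ω π' < pathCost ω π → π' ∈ σ.found
  enough : (κ : ℕ∞) ≤ σ.found.encard ∨ solutionPaths (stopAt G t) s t ⊆ σ.found

section Runs

variable {G : Digraph V} {ω : V → V → ℕ} {s t : V} {κ : ℕ} {h : V → ℝ≥0} {σ σ' : State V}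
  {ρ : ℕ → State V}

theorem RunInv.initial (hst : s ≠ t) (hκ : 0 < κ) : RunInv G ω s t κ h (initial s t) where
  search := .initial
  centroids := .initial hst
  found_lt := by simpa [Bela.initial] using hκ
  not_halted := by simp [Bela.initial]

/-- A step preserves the invariant or returns with enough paths. -/
theorem RunInv.step (H : RunInv G ω s t κ h σ) (hω : ∀ u v, G.Adj u v → 0 < ω u v)
    (hfin : ∀ u, {v | G.Adj u v}.Finite) (hst : s ≠ t) (hcons : IsConsistent G ω t h)
    (hstep : Step G ω s t κ h σ σ') : RunInv G ω s t κ h σ' ∨ Returned G ω s t κ σ' := by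
  obtain ⟨HS, HC, hlt, hnh⟩ := H
  cases hstep with
  | pop hc hn hmin => exact .inl ⟨HS.pop hc hn hmin, HC.pop hc hn, hlt, by simp⟩
  | exhausted hc ho => exact .inl ⟨HS.exhausted hc ho, HC.exhausted hc, hlt, by simp⟩
  | @consume z hz =>
    have HS' := HS.collect (z := z)
    have HC' := HC.collect HS hω hcons hz
    by_cases hκ : (κ : ℕ∞) ≤ (σ.found ∪ getPaths ω s t σ z).encard
    · exact .inr ⟨by simp [Bela.consume, hκ], HC'.sound, HC'.admissible, .inl hκ⟩
    · rw [not_le] at hκ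
      rw [consume_eq κ hκ]
      exact .inl ⟨HS', HC', hκ, hnh⟩
  | @goal n hc hZ hv =>
    rw [HC.reachGoal_eq HS hc hv]
    exact .inl ⟨HS.duplicate hst hc (.inl hv), HC.duplicate HS hω hcons hc, hlt,
      by simp [Bela.duplicate]⟩
  | duplicate hc hZ hvt hv =>
    exact .inl ⟨HS.duplicate hst hc (.inr hv), HC.duplicate HS hω hcons hc, hlt,
      by simp [Bela.duplicate]⟩
  | expand hc hZ hvt hv =>
    exact .inl ⟨HS.expand hfin hcons hc hvt hv, HC.expand HS hcons hc hvt hv, hlt,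
      by simp [Bela.expand]⟩
  | finish hc hZ =>
    refine .inr ⟨rfl, HC.sound, HC.admissible, .inr fun π hπ => ?_⟩
    by_contra hnot
    rcases HC.exists_pending_or_centroid HS hcons hπ hnot with ⟨x, hx | hx, -⟩ | ⟨z, hz, -⟩
    · simp [HS.final hc] at hx
    · simp [hc] at hx
    · simp [hZ] at hz

/-- The execution never gets stuck. -/
theorem RunInv.exists_step (H : RunInv G ω s t κ h σ) : ∃ σ', Step G ω s t κ h σ σ' := by
  have hcheapest : σ.Z.Nonempty → ∃ z ∈ σ.Z, ∀ z' ∈ σ.Z, z.cost ≤ z'.cost := by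
    intro hne
    obtain ⟨z, hz, hmin⟩ := (InvImage.wf Centroid.cost Nat.lt_wfRel.wf).has_min _ hne
    exact ⟨z, hz, fun z' hz' => not_lt.1 (hmin z' hz')⟩
  cases hc : σ.control with
  | outer =>
    rcases σ.opn.eq_empty_or_nonempty with ho | ho
    · exact ⟨_, .exhausted hc ho⟩
    · obtain ⟨n, hn, hmin⟩ := H.search.open_finite.exists_minimalFor (Node.f h) _ ho
      exact ⟨_, .pop hc hn fun m hm => (le_total _ _).elim id (hmin hm)⟩
  | inner n =>
    by_cases hZ : ∀ z ∈ σ.Z, n.f h < z.cost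
    · by_cases hv : n.vertex = t
      · exact ⟨_, .goal hc hZ hv⟩
      · by_cases he : n.vertex ∈ σ.expanded
        · exact ⟨_, .duplicate hc hZ hv he⟩
        · exact ⟨_, .expand hc hZ hv he⟩
    · push Not at hZ
      obtain ⟨z₀, hz₀, hle⟩ := hZ
      obtain ⟨z, hz, hmin⟩ := hcheapest ⟨z₀, hz₀⟩
      refine ⟨_, .consume ⟨hz, hmin, .inr ⟨n, hc, le_trans ?_ hle⟩⟩⟩
      exact_mod_cast hmin z₀ hz₀
  | final =>
    rcases σ.Z.eq_empty_or_nonempty with hZ | hZ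
    · exact ⟨_, .finish hc hZ⟩
    · obtain ⟨z, hz, hmin⟩ := hcheapest hZ
      exact ⟨_, .consume ⟨hz, hmin, .inl hc⟩⟩
  | halted => exact absurd hc H.not_halted

theorem not_step_of_halted (hc : σ.control = .halted) : ¬ Step G ω s t κ h σ σ' := by
  intro hstep
  cases hstep with
  | consume hz => obtain ⟨-, -, hz | ⟨n, hz, -⟩⟩ := hz <;> simp [hc] at hz
  | _ => simp_all

theorem IsRun.invariant (hρ : IsRun G ω s t κ h ρ) (hω : ∀ u v, G.Adj u v → 0 < ω u v)
    (hfin : ∀ u, {v | G.Adj u v}.Finite) (hst : s ≠ t) (hκ : 0 < κ)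
    (hcons : IsConsistent G ω t h) (i : ℕ) :
    RunInv G ω s t κ h (ρ i) ∨ Returned G ω s t κ (ρ i) := by
  induction i with
  | zero => rw [hρ.1]; exact .inl (.initial hst hκ)
  | succ i ih =>
    rcases hρ.2 i with hstep | ⟨-, heq⟩
    · rcases ih with H | H
      · exact H.step hω hfin hst hcons hstep
      · exact absurd hstep (not_step_of_halted H.halted)
    · rwa [heq]

theorem Step.found_subset (hstep : Step G ω s t κ h σ σ') : σ.found ⊆ σ'.found := by
  cases hstep with
  | consume _ => exact Set.subset_union_left
  | _ => exact subset_rfl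

theorem IsRun.found_mono (hρ : IsRun G ω s t κ h ρ) : Monotone fun i => (ρ i).found := by
  refine monotone_nat_of_le_succ fun i => ?_
  rcases hρ.2 i with hstep | ⟨-, heq⟩
  · exact hstep.found_subset
  · rw [heq]

/-! ### Progress -/

/-- The stored edges that can be reached at cost at most `C`. -/
def storedUpTo (ω : V → V → ℕ) (C : ℕ) (σ : State V) : Set (V × V) :=
  {e | e ∈ σ.edges ∧ σ.g e.1 + ω e.1 e.2 ≤ C}

/-- The pairs of a stored edge and a backward cost at its end, of overall cost at most `C`, whose
centroid is not pending. -/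
def settledUpTo (ω : V → V → ℕ) (C : ℕ) (σ : State V) : Set (V × V × ℕ) :=
  {e | (e.1, e.2.1) ∈ σ.edges ∧ e.2.2 ∈ σ.gb e.2.1 ∧
    ⟨e.1, e.2.1, σ.g e.1 + ω e.1 e.2.1 + e.2.2⟩ ∉ σ.Z ∧ σ.g e.1 + ω e.1 e.2.1 + e.2.2 ≤ C}

/-- `1` in the states that are reached by popping a node or by finding OPEN empty, as these steps
make no other progress. -/
def Control.rank : Control V → ℕ
  | .inner _ => 1
  | .final => 1
  | _ => 0

theorem Control.rank_le_one (c : Control V) : c.rank ≤ 1 := by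
  cases c <;> simp [Control.rank]

open Classical in
/-- A measure that increases with every step of overall cost at most `C` but remains bounded. The
factor `3` outweighs the possible loss of rank when a popped node is processed; the expansion of the
start vertex, which stores no edge, is counted separately. -/
noncomputable def progress (ω : V → V → ℕ) (s : V) (C : ℕ) (σ : State V) : ℕ :=
  3 * ((storedUpTo ω C σ).ncard + (settledUpTo ω C σ).ncard + if s ∈ σ.expanded then 1 else 0) +
    σ.control.rank

/-- In the state `σ`, only centroids of cost at most `C` and nodes of `g`-value at most `C` can be
processed. -/
def Low (h : V → ℝ≥0) (C : ℕ) (σ : State V) : Prop :=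
  (∀ z, MayConsume h σ z → z.cost ≤ C) ∧
    ∀ x, σ.control = .inner x → (∀ z ∈ σ.Z, x.f h < z.cost) → x.g ≤ C

theorem RunInv.stored_subset (H : RunInv G ω s t κ h σ) (C : ℕ) {p v : V} (hE : (p, v) ∈ σ.edges)
    (hC : σ.g p + ω p v ≤ C) :
    p ∈ {v | ∃ π, IsPath (stopAt G t) s v π ∧ pathCost ω π ≤ C} ∧
      v ∈ {v | ∃ π, IsPath (stopAt G t) s v π ∧ pathCost ω π ≤ C} := by
  obtain ⟨hp, hadj, -⟩ := H.search.edge p v hE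
  obtain ⟨π, hπ, hcost⟩ := H.search.path p hp
  refine ⟨⟨π, hπ, by omega⟩, _, hπ.snoc hadj, ?_⟩
  rw [hπ.cost_snoc]
  omega

/-- Only finitely many edges and backward costs can be involved in work of cost at most `C`. -/
theorem exists_finite_bound (hω : ∀ u v, G.Adj u v → 0 < ω u v)
    (hfin : ∀ u, {v | G.Adj u v}.Finite) (C : ℕ) :
    ∃ (S : Set (V × V)) (T : Set (V × V × ℕ)), S.Finite ∧ T.Finite ∧ ∀ κ σ,
      RunInv G ω s t κ h σ → storedUpTo ω C σ ⊆ S ∧ settledUpTo ω C σ ⊆ T := by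
  have hF := finite_reachable_of_cost_le (G := stopAt G t) (ω := ω)
    (fun u v huv => hω u v huv.1) (fun u => (hfin u).subset fun v hv => hv.1) s C
  refine ⟨_, _, hF.prod hF, hF.prod (hF.prod (Set.finite_Iic C)), fun κ σ H => ⟨?_, ?_⟩⟩
  · rintro ⟨p, v⟩ ⟨hE, hC⟩
    exact H.stored_subset C hE hC
  · rintro ⟨p, v, c⟩ ⟨hE, -, -, hC⟩
    change σ.g p + ω p v + c ≤ C at hC
    have := H.stored_subset C (p := p) (v := v) hE (by omega)
    exact ⟨this.1, this.2, show c ≤ C by omega⟩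

theorem exists_progress_le (hω : ∀ u v, G.Adj u v → 0 < ω u v)
    (hfin : ∀ u, {v | G.Adj u v}.Finite) (C : ℕ) :
    ∃ B, ∀ σ, RunInv G ω s t κ h σ → progress ω s C σ ≤ B := by
  obtain ⟨S, T, hS, hT, hST⟩ := exists_finite_bound (s := s) (t := t) (h := h) hω hfin C
  refine ⟨3 * (S.ncard + T.ncard + 1) + 1, fun σ H => ?_⟩
  have h1 := Set.ncard_le_ncard (hST κ σ H).1 hS
  have h2 := Set.ncard_le_ncard (hST κ σ H).2 hT
  have h3 := σ.control.rank_le_one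
  unfold progress
  split_ifs <;> omega


theorem progress_lt_of_ssubset {C : ℕ} (hA : (storedUpTo ω C σ').Finite)
    (hD : (settledUpTo ω C σ').Finite) (hAs : storedUpTo ω C σ ⊆ storedUpTo ω C σ')
    (hDs : settledUpTo ω C σ ⊆ settledUpTo ω C σ') (hs : s ∈ σ.expanded → s ∈ σ'.expanded)
    (hne : (∃ e ∈ storedUpTo ω C σ', e ∉ storedUpTo ω C σ) ∨
      (∃ e ∈ settledUpTo ω C σ', e ∉ settledUpTo ω C σ) ∨ (s ∈ σ'.expanded ∧ s ∉ σ.expanded)) :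
    progress ω s C σ < progress ω s C σ' := by
  have h1 := Set.ncard_le_ncard hAs hA
  have h2 := Set.ncard_le_ncard hDs hD
  have h3 := σ.control.rank_le_one
  have h4 : (storedUpTo ω C σ).ncard < (storedUpTo ω C σ').ncard ∨
      (settledUpTo ω C σ).ncard < (settledUpTo ω C σ').ncard ∨
      (s ∈ σ'.expanded ∧ s ∉ σ.expanded) := by
    rcases hne with ⟨e, he, hne⟩ | ⟨e, he, hne⟩ | hne
    · exact .inl (Set.ncard_lt_ncard (hAs.ssubset_of_not_subset fun hsub => hne (hsub he)) hA)
    · exact .inr (.inl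
        (Set.ncard_lt_ncard (hDs.ssubset_of_not_subset fun hsub => hne (hsub he)) hD))
    · exact .inr (.inr hne)
  unfold progress
  split_ifs <;> simp_all <;> omega

theorem settledUpTo_subset_collect {z : Centroid V} (C : ℕ) :
    settledUpTo ω C σ ⊆ settledUpTo ω C (collect ω s t σ z) := by
  rintro ⟨p, v, c⟩ ⟨hE, hc, hno, hC⟩
  refine ⟨hE, .inl hc, ?_, hC⟩
  rintro (hz | ⟨p', n, c', -, hnew, -, -, heq⟩)
  · exact hno hz.1
  · simp only [Centroid.mk.injEq] at heq
    obtain ⟨rfl, rfl, heq⟩ := heq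
    change σ.g p + ω p v + c = σ.g p + ω p v + c' at heq
    exact hnew (by rwa [show c' = c by omega])

/-- The processed centroid itself becomes settled. -/
theorem RunInv.exists_settled_collect (H : RunInv G ω s t κ h σ) {z : Centroid V} (hz : z ∈ σ.Z)
    {C : ℕ} (hC : z.cost ≤ C) :
    ∃ e ∈ settledUpTo ω C (collect ω s t σ z), e ∉ settledUpTo ω C σ := by
  obtain ⟨hE, c, hc, hcost⟩ := H.centroids.centroid z hz
  have hzeq : (⟨z.src, z.dst, σ.g z.src + ω z.src z.dst + c⟩ : Centroid V) = z := by
    rw [← hcost]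
  refine ⟨(z.src, z.dst, c), ⟨hE, .inl hc, ?_, hcost ▸ hC⟩, fun hmem => hmem.2.2.1 ?_⟩
  · change (⟨z.src, z.dst, σ.g z.src + ω z.src z.dst + c⟩ : Centroid V) ∉ _
    rw [hzeq]
    rintro (hz' | ⟨p, n, c', -, hnew, -, -, heq⟩)
    · exact hz'.2 rfl
    · obtain rfl : z.src = p := congrArg Centroid.src heq
      obtain rfl : z.dst = n := congrArg Centroid.dst heq
      have hcost' : z.cost = σ.g z.src + ω z.src z.dst + c' := congrArg Centroid.cost heq
      exact hnew (by rwa [show c' = c by omega])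
  · change (⟨z.src, z.dst, σ.g z.src + ω z.src z.dst + c⟩ : Centroid V) ∈ _
    rwa [hzeq]

theorem RunInv.progress_duplicate (H : RunInv G ω s t κ h σ) (hst : s ≠ t) {x : Node V} {C : ℕ}
    (hA : (storedUpTo ω C (duplicate ω σ x)).Finite)
    (hD : (settledUpTo ω C (duplicate ω σ x)).Finite) (hc : σ.control = .inner x)
    (hv : x.vertex = t ∨ x.vertex ∈ σ.expanded) (hC : x.g ≤ C) :
    progress ω s C σ < progress ω s C (duplicate ω σ x) := by
  have hx : Pending σ x := .inr hc
  obtain ⟨p, hp⟩ := H.search.exists_parent hst hx hv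
  obtain ⟨-, -, hg, hnew⟩ := H.search.pending_edge x p hx hp
  refine progress_lt_of_ssubset hA hD ?_ ?_ id (.inl ⟨(p, x.vertex), ⟨.inr ⟨p, hp, rfl⟩, ?_⟩,
    fun hmem => hnew hmem.1⟩)
  · exact fun e he => ⟨.inl he.1, he.2⟩
  · rintro ⟨q, v, c⟩ ⟨hE, hc', hno, hC⟩
    refine ⟨.inl hE, hc', ?_, hC⟩
    rintro (hz | ⟨p', c', hp', -, heq⟩)
    · exact hno hz
    · simp only [Centroid.mk.injEq] at heq
      obtain ⟨rfl, rfl, -⟩ := heq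
      exact (H.search.pending_edge x _ hx hp').2.2.2 hE
  · exact hg ▸ hC

theorem RunInv.progress_expand (H : RunInv G ω s t κ h σ) {x : Node V} {C : ℕ}
    (hA : (storedUpTo ω C (expand G ω σ x)).Finite)
    (hD : (settledUpTo ω C (expand G ω σ x)).Finite) (hc : σ.control = .inner x)
    (hv : x.vertex ∉ σ.expanded) (hC : x.g ≤ C) :
    progress ω s C σ < progress ω s C (expand G ω σ x) := by
  have hx : Pending σ x := .inr hc
  have hold : ∀ p ∈ σ.expanded, (Bela.expand G ω σ x).g p = σ.g p := fun p hp =>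
    expand_g_of_ne fun hpx => hv (hpx ▸ hp)
  refine progress_lt_of_ssubset hA hD ?_ ?_ .inr ?_
  · rintro ⟨p, v⟩ ⟨hE, hC⟩
    refine ⟨.inl hE, ?_⟩
    rwa [hold p (H.search.edge p v hE).1]
  · rintro ⟨p, v, c⟩ ⟨hE, hc', hno, hC⟩
    refine ⟨.inl hE, hc', ?_⟩
    rw [hold p (H.search.edge p v hE).1]
    exact ⟨hno, hC⟩
  · cases hp : x.parent with
    | none =>
      obtain ⟨hs, rfl⟩ := H.search.pending_start x hx hp
      exact .inr (.inr ⟨.inl rfl, hs⟩)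
    | some p =>
      obtain ⟨hpe, -, hg, hnew⟩ := H.search.pending_edge x p hx hp
      refine .inl ⟨(p, x.vertex), ⟨.inr ⟨p, hp, rfl⟩, ?_⟩, fun hmem => hnew hmem.1⟩
      rw [hold p hpe]
      exact hg ▸ hC

theorem RunInv.progress_lt (H : RunInv G ω s t κ h σ) (hω : ∀ u v, G.Adj u v → 0 < ω u v)
    (hfin : ∀ u, {v | G.Adj u v}.Finite) (hst : s ≠ t) (H' : RunInv G ω s t κ h σ')
    (hstep : Step G ω s t κ h σ σ') {C : ℕ} (hlow : Low h C σ) :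
    progress ω s C σ < progress ω s C σ' := by
  obtain ⟨S, T, hS, hT, hST⟩ := exists_finite_bound (s := s) (t := t) (h := h) hω hfin C
  have hA : (storedUpTo ω C σ').Finite := hS.subset (hST κ σ' H').1
  have hD : (settledUpTo ω C σ').Finite := hT.subset (hST κ σ' H').2
  cases hstep with
  | @pop n hc hn hmin =>
    have h1 : progress ω s C { σ with opn := σ.opn \ {n}, control := .inner n } =
      progress ω s C { σ with control := .outer } + 1 := rfl
    rw [h1, ← hc]
    exact Nat.lt_succ_self _
  | exhausted hc ho =>
    have h1 : progress ω s C { σ with control := .final } =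
      progress ω s C { σ with control := .outer } + 1 := rfl
    rw [h1, ← hc]
    exact Nat.lt_succ_self _
  | @consume z hz =>
    by_cases hκ : (κ : ℕ∞) ≤ (σ.found ∪ getPaths ω s t σ z).encard
    · exact absurd (by simp [Bela.consume, hκ]) H'.not_halted
    · rw [consume_eq κ (not_le.1 hκ)] at hA hD ⊢
      exact progress_lt_of_ssubset hA hD (fun _ he => he) (settledUpTo_subset_collect C) id
        (.inr (.inl (H.exists_settled_collect hz.1 (hlow.1 z hz))))
  | @goal n hc hZ hv =>
    rw [H.centroids.reachGoal_eq H.search hc hv] at hA hD ⊢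
    exact H.progress_duplicate hst hA hD hc (.inl hv) (hlow.2 n hc hZ)
  | duplicate hc hZ hvt hv => exact H.progress_duplicate hst hA hD hc (.inr hv) (hlow.2 _ hc hZ)
  | expand hc hZ hvt hv => exact H.progress_expand hA hD hc hv (hlow.2 _ hc hZ)
  | finish hc hZ => exact absurd rfl H'.not_halted

/-- An execution that never returns cannot restrict itself to work of bounded cost. -/
theorem IsRun.exists_not_low (hρ : IsRun G ω s t κ h ρ) (hω : ∀ u v, G.Adj u v → 0 < ω u v)
    (hfin : ∀ u, {v | G.Adj u v}.Finite) (hst : s ≠ t) (hinv : ∀ i, RunInv G ω s t κ h (ρ i))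
    (C : ℕ) : ∃ i, ¬ Low h C (ρ i) := by
  by_contra! hlow
  obtain ⟨B, hB⟩ := exists_progress_le (s := s) (t := t) (κ := κ) (h := h) hω hfin C
  have hlt : ∀ i, progress ω s C (ρ i) < progress ω s C (ρ (i + 1)) := by
    intro i
    rcases hρ.2 i with hstep | ⟨hno, -⟩
    · exact (hinv i).progress_lt hω hfin hst (hinv (i + 1)) hstep (hlow i)
    · obtain ⟨σ', hσ'⟩ := (hinv i).exists_step
      exact absurd hσ' (hno σ')
  have := (strictMono_nat_of_lt_succ hlt).id_le (B + 1)
  have := hB _ (hinv (B + 1))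
  simp only [id] at *
  omega

/-- As long as a solution path has not been found, only work of at most its cost is done. -/
theorem RunInv.low_of_not_found (H : RunInv G ω s t κ h σ) (hcons : IsConsistent G ω t h)
    {π : List V} (hπ : π ∈ solutionPaths (stopAt G t) s t) (hnot : π ∉ σ.found) :
    Low h (pathCost ω π) σ := by
  have key := H.centroids.exists_pending_or_centroid H.search hcons hπ hnot
  constructor
  · intro z hz
    rcases key with ⟨x, hx, hf⟩ | ⟨z', hz', hle⟩
    · exact_mod_cast (hz.le_f H.search hx).trans hf
    · exact (hz.2.1 z' hz').trans hle
  · intro x hx hZ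
    have hf : x.f h ≤ pathCost ω π := by
      rcases key with ⟨y, hy | hy, hf⟩ | ⟨z', hz', hle⟩
      · exact ((H.search.inner_le x hx).2 y hy).trans hf
      · rw [hx] at hy
        obtain rfl := Control.inner.inj hy
        exact hf
      · exact (hZ z' hz').le.trans (by exact_mod_cast hle)
    have : (x.g : ℝ≥0) ≤ pathCost ω π := (le_add_of_nonneg_right (zero_le)).trans hf
    exact_mod_cast this

/-- An execution that never returns finds every solution path. -/
theorem IsRun.exists_found (hρ : IsRun G ω s t κ h ρ) (hω : ∀ u v, G.Adj u v → 0 < ω u v)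
    (hfin : ∀ u, {v | G.Adj u v}.Finite) (hst : s ≠ t) (hcons : IsConsistent G ω t h)
    (hinv : ∀ i, RunInv G ω s t κ h (ρ i)) {π : List V}
    (hπ : π ∈ solutionPaths (stopAt G t) s t) : ∃ i, π ∈ (ρ i).found := by
  by_contra! hnot
  obtain ⟨i, hi⟩ := hρ.exists_not_low hω hfin hst hinv (pathCost ω π)
  exact hi ((hinv i).low_of_not_found hcons hπ (hnot i))

/-- An execution that never returns has fewer than `κ` paths to find. -/
theorem IsRun.encard_solutionPaths_lt (hρ : IsRun G ω s t κ h ρ)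
    (hω : ∀ u v, G.Adj u v → 0 < ω u v)
    (hfin : ∀ u, {v | G.Adj u v}.Finite) (hst : s ≠ t) (hcons : IsConsistent G ω t h)
    (hinv : ∀ i, RunInv G ω s t κ h (ρ i)) :
    (solutionPaths (stopAt G t) s t).encard < κ := by
  by_contra! hle
  obtain ⟨P, hP, hcard⟩ := Set.exists_subset_encard_eq hle
  have hfinP : P.Finite := Set.finite_of_encard_eq_coe hcard
  choose! f hf using fun π (hπ : π ∈ P) => hρ.exists_found hω hfin hst hcons hinv (hP hπ)
  obtain ⟨i, hi⟩ := (hfinP.image f).bddAbove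
  have hi : P ⊆ (ρ i).found := fun π hπ => hρ.found_mono (hi ⟨π, hπ, rfl⟩) (hf π hπ)
  have := (Set.encard_le_encard hi).trans_lt (hinv i).found_lt
  rw [hcard] at this
  exact lt_irrefl _ this

/-- If only finitely many vertices can be reached and there are fewer than `κ` solution paths, then all
costs that can occur are bounded, as those of centroids are costs of solution paths. -/
theorem RunInv.exists_low (hcons : IsConsistent G ω t h)
    (hreach : {v | Relation.ReflTransGen (stopAt G t).Adj s v}.Finite)
    (hsol : (solutionPaths (stopAt G t) s t).Finite) :
    ∃ C, ∀ σ, RunInv G ω s t κ h σ → Low h C σ := by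
  obtain ⟨B, hB⟩ := (hsol.image (pathCost ω)).bddAbove
  obtain ⟨B', hB'⟩ := ((hreach.prod hreach).image
    fun e : V × V => gStar (stopAt G t) ω s e.1 + ω e.1 e.2).bddAbove
  refine ⟨max B B', fun σ H => ⟨fun z hz => ?_, fun x hx _ => ?_⟩⟩
  · obtain ⟨π, hπ, hcost⟩ := H.centroids.exists_path_of_centroid H.search hz.1
    exact le_max_of_le_left (hcost ▸ hB ⟨π, hπ, rfl⟩)
  · cases hp : x.parent with
    | none => simp [(H.search.pending_start x (.inr hx) hp).2]
    | some p =>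
      obtain ⟨hpe, hadj, hg, -⟩ := H.search.pending_edge x p (.inr hx) hp
      obtain ⟨π, hπ, -⟩ := H.search.path p hpe
      rw [hg, H.search.g_eq_gStar hcons hpe]
      exact le_max_of_le_right
        (hB' ⟨(p, x.vertex), ⟨hπ.reflTransGen, hπ.reflTransGen.tail hadj⟩, rfl⟩)

end Runs

/-! ### Completeness and admissibility -/

section Main

variable {G : Digraph V} {ω : V → V → ℕ} {s t : V} {κ : ℕ} {h : V → ℝ≥0} {σ σ' : State V}
  {ρ : ℕ → State V}

theorem Returned.exists_isKShortest (H : Returned G ω s t κ σ) :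
    ∃ P ⊆ σ.found, IsKShortest (stopAt G t) ω s t κ P :=
  exists_isKShortest_subset H.sound H.admissible H.enough

theorem IsRun.isCompleteAdmissible (hρ : IsRun G ω s t κ h ρ)
    (hω : ∀ u v, G.Adj u v → 0 < ω u v) (hfin : ∀ u, {v | G.Adj u v}.Finite) (hst : s ≠ t)
    (hκ : 0 < κ) (hcons : IsConsistent G ω t h) :
    IsCompleteAdmissible (stopAt G t) ω s t κ ρ := by
  have hinv := hρ.invariant hω hfin hst hκ hcons
  refine ⟨?_, ?_, ?_, ?_, ?_⟩
  · by_cases hret : ∃ i, Returned G ω s t κ (ρ i)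
    · obtain ⟨i, hi⟩ := hret
      obtain ⟨P, hP, hK⟩ := hi.exists_isKShortest
      exact ⟨P, hK, fun π hπ => ⟨i, hP hπ⟩⟩
    · obtain ⟨P, -, hK⟩ := exists_isKShortest_subset (ω := ω) (κ := κ)
        (subset_refl (solutionPaths (stopAt G t) s t)) (fun _ _ _ hπ _ => hπ) (.inr subset_rfl)
      refine ⟨P, hK, fun π hπ => hρ.exists_found hω hfin hst hcons (fun i => ?_) (hK.subset hπ)⟩
      exact (hinv i).resolve_right fun hi => hret ⟨i, hi⟩
  · intro hor
    by_contra! hnot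
    have hinv' : ∀ i, RunInv G ω s t κ h (ρ i) := fun i =>
      (hinv i).resolve_right fun hi => hnot i hi.halted
    have hlt := hρ.encard_solutionPaths_lt hω hfin hst hcons hinv'
    rcases hor with hle | hreach
    · exact absurd hle (not_le.2 hlt)
    · obtain ⟨C, hC⟩ := RunInv.exists_low (ω := ω) (κ := κ) hcons hreach
        (Set.finite_of_encard_le_coe hlt.le)
      obtain ⟨i, hi⟩ := hρ.exists_not_low hω hfin hst hinv' C
      exact hi (hC _ (hinv' i))
  · intro i hi
    exact ((hinv i).resolve_left fun H => H.not_halted hi).exists_isKShortest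
  · intro i
    rcases hinv i with H | H
    · exact H.centroids.sound
    · exact H.sound
  · intro i
    rcases hinv i with H | H
    · exact H.centroids.admissible
    · exact H.admissible

/-! ### Recovering paths from their centroids -/

theorem SearchInv.isChain_of_isPrefix (H : SearchInv G ω s t h σ) (hcons : IsConsistent G ω t h)
    {v : V} {φ : List V} (hφ : IsPrefix ω s σ v φ) (hv : v ∈ σ.expanded) :
    φ.IsChain (IsTreeEdge (stopAt G t) ω s) := by
  induction hφ with
  | start => simp
  | @snoc n p l _ hE hg hp ih =>
    obtain ⟨hpe, hadj, -⟩ := H.edge _ _ hE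
    refine (ih hpe).append (by simp) ?_
    intro a ha b hb
    obtain rfl : p = a := by simpa [(H.isPath_of_isPrefix hp).1.2.2] using ha
    obtain rfl : n = b := by simpa using hb
    exact ⟨hadj, by rw [← H.g_eq_gStar hcons hv, ← H.g_eq_gStar hcons hpe, hg]⟩

/-- With the zero heuristic, every centroid whose edge does not end in the goal belongs to a sidetrack
edge, so that the paths delivered by a centroid are paths of that very centroid. -/
theorem RunInv.isCentroidOf (H : RunInv G ω s t κ h σ) (hcons : IsConsistent G ω t h)
    (h0 : ∀ v, h v = 0) {z : Centroid V} (hz : z ∈ σ.Z) {π : List V}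
    (hπ : π ∈ getPaths ω s t σ z) : IsCentroidOf (stopAt G t) ω s z π := by
  obtain ⟨HS, HC, -, -⟩ := H
  have hE := (HC.centroid z hz).1
  obtain ⟨hsrc, hadj, hdst⟩ := HS.edge _ _ hE
  refine ⟨(HS.isPath_of_mem_getPaths hE hπ).2.symm, ?_⟩
  obtain ⟨φ, τ, c, hφ, hτ, -, rfl⟩ := hπ
  refine ⟨φ, τ, rfl, (HS.isPath_of_isPrefix hφ).1.2.2, ?_, HS.isChain_of_isPrefix hcons hφ hsrc, ?_⟩
  · exact (isPath_of_isSuffix (σ := afterPrefixes ω s σ z)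
      (fun u v hE => (HS.edge u v hE).2.1) hτ).1.2.1
  · by_cases hd : z.dst = t
    · have hτ' : τ = [z.dst] := by
        rw [hd] at hτ ⊢
        cases hτ with
        | goal => rfl
        | cons hne => exact absurd rfl hne
      obtain ⟨φ', hφ', hcost⟩ := HS.path _ hsrc
      have hle := gStar_le (ω := ω) (hφ'.snoc hadj)
      rw [hφ'.cost_snoc, hcost, HS.g_eq_gStar hcons hsrc] at hle
      rcases hle.lt_or_eq with hlt | heq
      · exact .inl ⟨hadj, hlt⟩
      · exact .inr ⟨⟨hadj, heq⟩, hτ'⟩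
    · left
      have hlt := HC.sidetrack h0 z hz hd
      rw [HS.g_eq_gStar hcons hsrc, HS.g_eq_gStar hcons (hdst hd).1] at hlt
      exact ⟨hadj, hlt⟩

/-- Paths are found by processing centroids only. -/
theorem Step.mem_found (hstep : Step G ω s t κ h σ σ') {π : List V} (hπ : π ∈ σ'.found) :
    π ∈ σ.found ∨ ∃ z, MayConsume h σ z ∧ σ' = Bela.consume ω s t κ σ z ∧ π ∈ getPaths ω s t σ z := by
  cases hstep with
  | @consume z hz => exact hπ.imp id fun hπ => ⟨z, hz, rfl, hπ⟩
  | _ => exact .inl hπ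

theorem IsRun.recoversFromCentroids (hρ : IsRun G ω s t κ h ρ)
    (hω : ∀ u v, G.Adj u v → 0 < ω u v) (hfin : ∀ u, {v | G.Adj u v}.Finite) (hst : s ≠ t)
    (hκ : 0 < κ) (hcons : IsConsistent G ω t h) (h0 : ∀ v, h v = 0) :
    RecoversFromCentroids (stopAt G t) ω s t κ h ρ := by
  intro j π hπ
  induction j with
  | zero => rw [hρ.1] at hπ; exact hπ.elim
  | succ j ih =>
    by_cases hold : π ∈ (ρ j).found
    · obtain ⟨i, hi, hz⟩ := ih hold
      exact ⟨i, by omega, hz⟩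
    · rcases hρ.2 j with hstep | ⟨-, heq⟩
      · obtain ⟨z, hz, heq, hmem⟩ := (hstep.mem_found hπ).resolve_left hold
        have hinv : RunInv G ω s t κ h (ρ j) :=
          (hρ.invariant hω hfin hst hκ hcons j).resolve_right fun H =>
            not_step_of_halted H.halted hstep
        exact ⟨j, by omega, z, hz, heq, hmem, hinv.isCentroidOf hcons h0 hz.1 hmem⟩
      · exact absurd (heq ▸ hπ) hold

/-! ### Goals on no directed cycle -/

theorem IsPath.of_stopAt {v : V} {π : List V} (hπ : IsPath (stopAt G t) s v π) : IsPath G s v π :=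
  ⟨hπ.1.imp fun _ _ huv => huv.1, hπ.2⟩

/-- If the goal lies on no directed cycle, a path that can be continued to the goal does not visit it
before its end. -/
theorem isPath_stopAt_iff (hcyc : ¬ Relation.TransGen G.Adj t t) {v : V} {π : List V}
    (hv : Relation.ReflTransGen G.Adj v t) : IsPath (stopAt G t) s v π ↔ IsPath G s v π := by
  refine ⟨IsPath.of_stopAt, fun hπ => ?_⟩
  revert hv
  refine IsPath.snoc_induction (motive := fun v π => Relation.ReflTransGen G.Adj v t →
    IsPath (stopAt G t) s v π) ?_ ?_ hπ
  · exact fun _ => .refl _ _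
  · intro u v π _ huv ih hv
    refine (ih (.head huv hv)).snoc ⟨huv, ?_⟩
    rintro rfl
    exact hcyc (.head' huv hv)

theorem solutionPaths_stopAt (hcyc : ¬ Relation.TransGen G.Adj t t) :
    solutionPaths (stopAt G t) s t = solutionPaths G s t :=
  Set.ext fun _ => isPath_stopAt_iff hcyc .refl

theorem gStar_stopAt (hcyc : ¬ Relation.TransGen G.Adj t t) {v : V}
    (hv : Relation.ReflTransGen G.Adj v t) : gStar (stopAt G t) ω s v = gStar G ω s v := by
  simp only [gStar, isPath_stopAt_iff hcyc hv]

theorem IsKShortest.of_stopAt (hcyc : ¬ Relation.TransGen G.Adj t t) {P : Set (List V)}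
    (hP : IsKShortest (stopAt G t) ω s t κ P) : IsKShortest G ω s t κ P := by
  obtain ⟨h1, h2, h3, h4⟩ := hP
  rw [solutionPaths_stopAt hcyc] at h1 h2 h3 h4
  exact ⟨h1, h2, h3, h4⟩

theorem IsCompleteAdmissible.of_stopAt (hcyc : ¬ Relation.TransGen G.Adj t t)
    (H : IsCompleteAdmissible (stopAt G t) ω s t κ ρ) : IsCompleteAdmissible G ω s t κ ρ := by
  obtain ⟨⟨P, hP, hfound⟩, hreturns, hreturned, hsound, hadm⟩ := H
  rw [solutionPaths_stopAt hcyc] at hreturns hsound hadm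
  refine ⟨⟨P, hP.of_stopAt hcyc, hfound⟩, fun hor => hreturns (hor.imp id fun hf => ?_),
    fun i hi => ?_, hsound, hadm⟩
  · exact hf.subset fun v hv => Relation.ReflTransGen.mono (fun _ _ huv => huv.1) _ _ hv
  · obtain ⟨P, hsub, hP⟩ := hreturned i hi
    exact ⟨P, hsub, hP.of_stopAt hcyc⟩

theorem IsTreeEdge.of_stopAt (hcyc : ¬ Relation.TransGen G.Adj t t) {u v : V}
    (hv : Relation.ReflTransGen G.Adj v t) (huv : IsTreeEdge (stopAt G t) ω s u v) :
    IsTreeEdge G ω s u v := by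
  obtain ⟨hadj, heq⟩ := huv
  rw [gStar_stopAt hcyc hv, gStar_stopAt hcyc (.head hadj.1 hv)] at heq
  exact ⟨hadj.1, heq⟩

theorem IsCentroidOf.of_stopAt (hcyc : ¬ Relation.TransGen G.Adj t t) {z : Centroid V}
    {π : List V} (hπ : π ∈ solutionPaths (stopAt G t) s t)
    (hz : IsCentroidOf (stopAt G t) ω s z π) : IsCentroidOf G ω s z π := by
  obtain ⟨hcost, φ, τ, rfl, hφ, hτ, hchain, hedge⟩ := hz
  have hreach : ∀ v ∈ φ ++ τ, Relation.ReflTransGen G.Adj v t := by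
    intro v hv
    obtain ⟨α, β, hαβ⟩ := List.append_of_mem hv
    exact (IsPath.suffix (α := α) (hαβ ▸ hπ)).of_stopAt.reflTransGen
  have hdst := hreach z.dst (List.mem_append_right _ (List.mem_of_mem_head? hτ))
  refine ⟨hcost, φ, τ, rfl, hφ, hτ, ?_, ?_⟩
  · exact hchain.imp_of_mem_imp fun a b _ hb hab =>
      hab.of_stopAt hcyc (hreach b (List.mem_append_left _ hb))
  · refine hedge.imp ?_ fun h => ⟨h.1.of_stopAt hcyc hdst, h.2⟩
    rintro ⟨hadj, hlt⟩
    rw [gStar_stopAt hcyc hdst, gStar_stopAt hcyc (.head hadj.1 hdst)] at hlt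
    exact ⟨hadj.1, hlt⟩

end Main

end Bela

theorem mainTheorem1 {V : Type*} (G : Digraph V) (ω : V → V → ℕ)
    (hω : ∀ u v, G.Adj u v → 0 < ω u v)
    (hfin : ∀ u, {v | G.Adj u v}.Finite)
    (s t : V) (hst : s ≠ t) (κ : ℕ) (hκ : 0 < κ)
    (h : V → NNReal) (hcons : Bela.IsConsistent G ω t h)
    (ρ : ℕ → Bela.State V) (hρ : Bela.IsRun G ω s t κ h ρ) :
    Bela.IsCompleteAdmissible (Bela.stopAt G t) ω s t κ ρ ∧
    ((∀ v, h v = 0) → Bela.RecoversFromCentroids (Bela.stopAt G t) ω s t κ h ρ) ∧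
    (¬ Relation.TransGen G.Adj t t →
      Bela.IsCompleteAdmissible G ω s t κ ρ ∧
      ((∀ v, h v = 0) → Bela.RecoversFromCentroids G ω s t κ h ρ)) := by
  have hC := hρ.isCompleteAdmissible hω hfin hst hκ hcons
  have hR := hρ.recoversFromCentroids hω hfin hst hκ hcons
  refine ⟨hC, hR, fun hcyc => ⟨hC.of_stopAt hcyc, fun h0 j π hπ => ?_⟩⟩
  obtain ⟨i, hi, z, hz, heq, hmem, hcent⟩ := hR h0 j π hπ
  exact ⟨i, hi, z, hz, heq, hmem, hcent.of_stopAt hcyc (hC.sound j hπ)⟩
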